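/- **Theorem (Quasi-invariant curves).** Let $E(z)=e^{2\pi i z}$. Let $g$ be an orientation preserving analytic circle diffeomorphism, given by its lift $G:\mathbb R\to\mathbb R$ (real analytic, $G'>0$, $G(x+1)=G(x)+1$), and suppose that its rotation number $\alpha=\lim_{k\to\infty} G^k(0)/k$ is irrational. Let $V\subset\mathbb C$ be an open neighborhood of $\mathbb S^1$ and denote again by $g:V\to\mathbb C$ a holomorphic extension of the circle map, so $g(E(x))=E(G(x))$ for $x\in\mathbb R$. Let $(p_n/q_n)_{n\ge 0}$ be the convergents of the continued fraction of $\alpha$ and let $m_n(x)=G^{q_n}(x)-x-p_n$. Then there is an increasing homeomorphism $h:\mathbb R\to\mathbb R$ with $h(x+1)=h(x)+1$ and $h^{-1}\circ G\circ h(x)=x+\alpha$. Put $\varphi_t(x)=h(h^{-1}(x)+t\alpha)$ and, for $z_0=x_0+i|m_n(x_0)|y_0$ with $x_0,y_0\in\mathbb R$, let $\Phi^{(n)}_{z_0}=\{\varphi_t(x_0)+i|m_n(\varphi_t(x_0))|y_0 : t\in\mathbb R\}$ be the flow line through $z_0$. For every $C_0>0$ there are $y_0>1/2$, $n_0\ge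 1$ and Jordan curves $(\gamma_n)_{n\ge n_0}$ contained in $\mathbb C\setminus\overline{\mathbb D}$ and homotopic to $\mathbb S^1$ in $\mathbb C\setminus\mathbb D$, such that for every $n\geq n_0$: 1. $\gamma_n$ is the image of a flow line $\Phi^{(n-1)}_{z_0}$, for some $z_0=x_0+i|m_{n-1}(x_0)|y_0$, under $z\mapsto E(\bar z)$, which maps the upper half plane onto $\mathbb C\setminus\overline{\mathbb D}$; 2. all iterates $g^j$, $0\le j\le q_n$, are defined on a neighborhood of the closure of the annulus bounded by $\mathbb S^1$ and $\gamma_n$; 3. for $0\le j\le q_n$, $g^j(\gamma_n)\subset\mathbb C\setminus\overline{\mathbb D}$ and $\mathcal D_P(g^j(\gamma_n),\gamma_n)\le C_0$; 4. for every $z\in\gamma_n$, $d_P(g^{q_n}(z),z)\le C_0$. Here $d_P$ is the Poincaré distance in $\mathbb C\setminus\overline{\mathbb D}$, i.e. the quotient of the hyperbolic distance of the upper half plane (metric $|d\xi|/\operatorname{Im}\xi$) under the universal covering $\xi\mapsto e^{-2\pi i\xi}$, and $\mathcal D_P$ is the associated Hausdorff distance. -/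

import Mathlib

open scoped ENNReal UpperHalfPlane

noncomputable section

namespace QuasiInvariant

/-- The exponential map `E(z) = exp (2πiz)` from `ℂ` to `ℂ \ {0}`; it maps `ℝ` onto the unit
circle. -/
def E (z : ℂ) : ℂ := Complex.exp (2 * Real.pi * Complex.I * z)

/-- `G` is (the lift to `ℝ` of) an orientation preserving analytic circle diffeomorphism.
That `G` is non-decreasing and `G (x + 1) = G x + 1` is part of `CircleDeg1Lift`. -/
structure IsAnalyticCircleDiffeo (G : CircleDeg1Lift) : Prop where
  analytic : AnalyticOnNhd ℝ G Set.univ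
  deriv_pos : ∀ x : ℝ, 0 < deriv G x

/-- `g`, considered on the open neighbourhood `V` of the unit circle, is a holomorphic extension
of the circle map with lift `G`. The values of `g` off `V` carry no information. -/
structure IsHolomorphicExtension (G : CircleDeg1Lift) (V : Set ℂ) (g : ℂ → ℂ) : Prop where
  isOpen : IsOpen V
  circle_subset : Metric.sphere (0 : ℂ) 1 ⊆ V
  holomorphic : DifferentiableOn ℂ g V
  semiconj : ∀ x : ℝ, g (E x) = E (G x)

/-- The numerator `p_n` of the `n`-th convergent of the continued fraction of `α`. -/
def p (α : ℝ) (n : ℕ) : ℤ := (α.convergent n).num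

/-- The denominator `q_n` of the `n`-th convergent of the continued fraction of `α`. -/
def q (α : ℝ) (n : ℕ) : ℕ := (α.convergent n).den

/-- `m_n(x) = G^{q_n}(x) - x - p_n`, where `p_n / q_n` are the convergents of the rotation number
of `G`. -/
def m (G : CircleDeg1Lift) (n : ℕ) (x : ℝ) : ℝ :=
  G^[q G.translationNumber n] x - x - p G.translationNumber n

/-- The increasing homeomorphism `h` of `ℝ` commutes with `x ↦ x + 1` and conjugates `G` to the
translation by its rotation number. -/
structure IsLinearization (G : CircleDeg1Lift) (h : ℝ ≃o ℝ) : Prop where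
  map_add_one : ∀ x : ℝ, h (x + 1) = h x + 1
  conj : ∀ x : ℝ, h.symm (G (h x)) = x + G.translationNumber

/-- The flow `φ_t = h ∘ T_{tα} ∘ h⁻¹` on the real line. -/
def realFlow (G : CircleDeg1Lift) (h : ℝ ≃o ℝ) (t x : ℝ) : ℝ :=
  h (h.symm x + t * G.translationNumber)

/-- The complex extension `φ_t^{(n)}` of the flow: `x + i |m_n(x)| y` is sent to
`φ_t(x) + i |m_n(φ_t(x))| y`. -/
def complexFlow (G : CircleDeg1Lift) (h : ℝ ≃o ℝ) (n : ℕ) (t : ℝ) (z : ℂ) : ℂ :=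
  ⟨realFlow G h t z.re, |m G n (realFlow G h t z.re)| * (z.im / |m G n z.re|)⟩

/-- The flow line `Φ_z^{(n)}` through `z`. -/
def flowLine (G : CircleDeg1Lift) (h : ℝ ≃o ℝ) (n : ℕ) (z : ℂ) : Set ℂ :=
  Set.range fun t : ℝ => complexFlow G h n t z

/-- The projection `z ↦ E(conj z)` of the upper half plane onto the exterior of the closed unit
disk, i.e. `E` followed by the reflection in the unit circle. It is `E` on the real line. -/
def toExterior (z : ℂ) : ℂ := E ((starRingEnd ℂ) z)

/-- The holomorphic universal covering `z ↦ exp (-2πiz)` of the exterior of the closed unit disk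
in `ℂ` by the upper half plane. -/
def extCover (z : ℍ) : ℂ := E (-(z : ℂ))

/-- The Poincaré distance in `ℂ \ closedDisk` (curvature `-1`): the quotient distance of the
hyperbolic distance of the upper half plane under the universal covering. It is `⊤` if one of the
points is not exterior to the closed disk. -/
def dP (z w : ℂ) : ℝ≥0∞ :=
  ⨅ (z' : ℍ) (w' : ℍ) (_ : extCover z' = z) (_ : extCover w' = w), edist z' w'

/-- The Hausdorff distance between sets associated to `dP`. -/
def hausdorffP (A B : Set ℂ) : ℝ≥0∞ :=
  max (⨆ a ∈ A, ⨅ b ∈ B, dP a b) (⨆ b ∈ B, ⨅ a ∈ A, dP b a)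

/-- The inclusion of the unit circle in `ℂ`. -/
def circleIncl : C(Circle, ℂ) := ⟨fun w => (w : ℂ), continuous_subtype_val⟩

/-- `γ` is a (parametrized) Jordan curve in the exterior of the closed unit disk, homotopic to the
unit circle in the complement of the open unit disk. -/
structure IsExteriorJordanCurve (γ : C(Circle, ℂ)) : Prop where
  injective : Function.Injective γ
  exterior : ∀ w, 1 < ‖γ w‖
  homotopic : ContinuousMap.HomotopicWith circleIncl γ fun c => ∀ w, 1 ≤ ‖c w‖

/-- The annulus bounded by the unit circle and a Jordan curve `Γ` around it: the points outside the
closed unit disk which lie in a bounded component of the complement of `Γ`. -/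
def annulus (Γ : Set ℂ) : Set ℂ :=
  {z | 1 < ‖z‖ ∧ z ∉ Γ ∧ Bornology.IsBounded (connectedComponentIn Γᶜ z)}

/-- The `j`-th iterate of the map `g` with domain `V` is defined on `W`. -/
def IterateDefinedOn (g : ℂ → ℂ) (V : Set ℂ) (j : ℕ) (W : Set ℂ) : Prop :=
  ∀ i < j, Set.MapsTo g^[i] W V

end QuasiInvariant

end

open QuasiInvariant

/-!
Let `H = h⁻¹` be the coordinate in which `G` is the translation by its rotation number `α`, and
put `θ_n = q_n α - p_n`. In this coordinate `G^{q_n} - p_n` is the translation by `θ_n`, so that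
`|m_n(x)|` is the displacement of that translation (`gap`). The flow is transitive on the line,
hence the curve `γ_n` is simply the curve at depth `y₀ |m_{n-1}(x)|` below the real line, read in
the exterior of the disk. Everything follows from two facts about the iterates `G^j`, `j ≤ q_n`:
near `x`, at the scale `|m_{n-1}(x)|`, they are nearly affine, on the line as well as in the
complex plane, and `|m_{n-1}|` is nearly invariant under `G^{q_n}`.

*The conjugacy.* Mathlib provides a monotone semiconjugacy to the rotation; it has no interval of
constancy by Denjoy's argument (`strictMono_of_semiconj`, `exists_isLinearization`).

*Combinatorics.* By best approximation (`abs_returnDist_le`) the first `q_n` iterates of the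
interval between `x` and `G^{q_{n-1}}(x) - p_{n-1}` are disjoint on the circle, so that their
lengths have bounded sum; moreover the first `q_n` iterates of a slightly larger interval around
any point cover the circle (`rotationScale`).

*Real estimates.* Disjointness bounds the distortion of `G^j` on such intervals. Small distortion
is obtained from the Schwarzian derivative. The nonlinearity `w = D log D G^l` satisfies `w' = w²
/ 2 + S(G^l)`, and `S(G^l)` is at most of order `max |m_{n-1}| / m_{n-1}(x)²`. At a maximum of
`|w|` one has `w² = -2 S(G^l)`, so that `|w|` is everywhere at most of order `√(max |m_{n-1}|) /
min |m_{n-1}|`, a good bound near the point where `|m_{n-1}|` is smallest. The cocycle relation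
for `w` and the covering property carry it to the whole circle, with `|m_{n-1}(x)|` in place of
the minimum (`abs_nonlinIter_mul_gap_le`). As `G^{q_n}` commutes with the iterates of `G` and has
derivative `1` somewhere, the same transport shows that its derivative is close to `1`
(`abs_log_derivIter_le`). The errors tend to `0` because the displacements do
(`exists_scaleEstimates`, `exists_gap_le`).

*Complex estimates.* Let `x + ζ_j` be lifts of the orbit of a point close to the circle, measured
from the real orbit, and let `u_j = ζ_j / D G^j(x)`. Then `1 / u_{j+1} - 1 / u_j` is `-N(G^j x) D
G^j(x) / 2` up to an error of order `(D G^j(x))² |u_j|`, where `N = G'' / G'`. These increments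
add up to `-w / 2` and a quantity controlled by `∑ (D G^j(x))²`, both small at the scale
`|m_{n-1}(x)|`. So `u_j` stays close to `u_0` (`dispIter_estimate`), and the orbit of a point of
`γ_n` stays hyperbolically close to `γ_n`. Under `G^{q_n}` the real part moves by at most a
constant times `|m_{n-1}(x)|`, which is hyperbolically small once `y₀` is large
(`curve_estimates`).
-/

namespace QuasiInvariant

/-! ### Continued fractions and best approximation -/

/-- The signed return distance `q_n α - p_n` of the rotation by `α` at its `n`-th closest return. -/
noncomputable def returnDist (α : ℝ) (n : ℕ) : ℝ := q α n * α - p α n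

lemma one_lt_inv_fract {α : ℝ} (hα : Irrational α) : 1 < (Int.fract α)⁻¹ := by
  have h0 : Int.fract α ≠ 0 := by
    intro h
    exact hα ⟨⌊α⌋, by have := Int.self_sub_floor α; rw [h] at this; push_cast; linarith⟩
  have h1 := Int.fract_lt_one α
  have h2 := Int.fract_nonneg α
  exact (one_lt_inv₀ (lt_of_le_of_ne h2 h0.symm)).2 h1

lemma irrational_inv_fract {α : ℝ} (hα : Irrational α) : Irrational (Int.fract α)⁻¹ := by
  rw [← Int.self_sub_floor]
  exact (hα.sub_intCast _).inv

lemma convergent_pos {ξ : ℝ} (h : 1 ≤ ξ) (n : ℕ) : 0 < ξ.convergent n := by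
  have hfl : (1 : ℚ) ≤ ⌊ξ⌋ := by exact_mod_cast Int.le_floor.2 (by simpa using h)
  have key : ∀ (n : ℕ) (ξ : ℝ), 0 ≤ ξ → 0 ≤ ξ.convergent n := by
    intro n
    induction n with
    | zero => intro ξ h; simpa using Int.floor_nonneg.2 h
    | succ n ih =>
      intro ξ h
      rw [Real.convergent_succ]
      have h1 := ih (Int.fract ξ)⁻¹ (inv_nonneg.2 (Int.fract_nonneg ξ))
      have h2 : (0 : ℚ) ≤ ⌊ξ⌋ := by exact_mod_cast Int.floor_nonneg.2 h
      positivity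
  cases n with
  | zero => rw [Real.convergent_zero]; linarith
  | succ n =>
    rw [Real.convergent_succ]
    have h1 := key n (Int.fract ξ)⁻¹ (inv_nonneg.2 (Int.fract_nonneg ξ))
    have : (0 : ℚ) ≤ ((Int.fract ξ)⁻¹.convergent n)⁻¹ := by positivity
    linarith

lemma q_pos (α : ℝ) (n : ℕ) : 0 < q α n := (α.convergent n).den_pos

lemma p_zero (α : ℝ) : p α 0 = ⌊α⌋ := by simp [p]

lemma q_zero (α : ℝ) : q α 0 = 1 := by simp [q]

lemma p_q_succ {α : ℝ} (hα : Irrational α) (n : ℕ) :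
    p α (n + 1) = ⌊α⌋ * p (Int.fract α)⁻¹ n + q (Int.fract α)⁻¹ n ∧
      (q α (n + 1) : ℤ) = p (Int.fract α)⁻¹ n := by
  have hpos := convergent_pos (one_lt_inv_fract hα).le n
  unfold p q
  rw [Real.convergent_succ]
  set r := (Int.fract α)⁻¹.convergent n
  have hnum : 0 < r.num := Rat.num_pos.2 hpos
  have hcop : Nat.Coprime (⌊α⌋ * r.num + r.den).natAbs r.num.natAbs := by
    rw [← Int.isCoprime_iff_nat_coprime]
    have h1 : IsCoprime (r.den : ℤ) r.num := by
      rw [Int.isCoprime_iff_nat_coprime]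
      simpa using r.reduced.symm
    simpa [add_comm] using h1.add_mul_right_left ⌊α⌋
  have heq : (⌊α⌋ : ℚ) + r⁻¹ = ((⌊α⌋ * r.num + r.den : ℤ) : ℚ) / (r.num : ℤ) := by
    have h0 : (r.num : ℚ) ≠ 0 := by exact_mod_cast hnum.ne'
    have h1 : r⁻¹ = (r.den : ℚ) / r.num := by
      conv_lhs => rw [← Rat.num_div_den r]
      rw [inv_div]
    rw [h1]
    push_cast
    field_simp
  rw [heq]
  exact ⟨Rat.num_div_eq_of_coprime hnum hcop, Rat.den_div_eq_of_coprime hnum hcop⟩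

lemma returnDist_zero (α : ℝ) : returnDist α 0 = Int.fract α := by
  simp [returnDist, p_zero, q_zero]

lemma returnDist_succ {α : ℝ} (hα : Irrational α) (n : ℕ) :
    returnDist α (n + 1) = -(Int.fract α * returnDist (Int.fract α)⁻¹ n) := by
  obtain ⟨h1, h2⟩ := p_q_succ hα n
  have h3 : (q α (n + 1) : ℝ) = p (Int.fract α)⁻¹ n := by exact_mod_cast h2
  have h0 : Int.fract α ≠ 0 := by
    intro h
    have := one_lt_inv_fract hα
    rw [h] at this
    norm_num at this
  unfold returnDist
  rw [h3, h1]
  have h4 : α = ⌊α⌋ + Int.fract α := (Int.floor_add_fract α).symm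
  have h5 : Int.fract α * (q (Int.fract α)⁻¹ n * (Int.fract α)⁻¹) = q (Int.fract α)⁻¹ n := by
    field_simp
  push_cast
  rw [mul_sub, h5]
  nth_rw 2 [h4]
  ring

/-- Successive return distances alternate in sign, decrease in size, and successive convergents
have determinant `±1`; all three facts propagate along `α ↦ 1 / fract α`. -/
lemma returnDist_step (n : ℕ) : ∀ {α : ℝ}, Irrational α →
    returnDist α n * returnDist α (n + 1) < 0 ∧ |returnDist α (n + 1)| < |returnDist α n| ∧
      |p α (n + 1) * q α n - p α n * q α (n + 1)| = 1 := by
  induction n with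
  | zero =>
    intro α hα
    have h1 := one_lt_inv_fract hα
    have h0 : 0 < Int.fract α := inv_pos.1 (by linarith)
    have h2 : 0 < Int.fract (Int.fract α)⁻¹ :=
      inv_pos.1 (lt_trans one_pos (one_lt_inv_fract (irrational_inv_fract hα)))
    have h3 := Int.fract_lt_one (Int.fract α)⁻¹
    obtain ⟨e1, e2⟩ := p_q_succ hα 0
    rw [zero_add] at e1 e2 ⊢
    rw [returnDist_succ hα 0, returnDist_zero, returnDist_zero, e1, e2, abs_neg,
      abs_of_pos (mul_pos h0 h2), abs_of_pos h0]
    refine ⟨by nlinarith [mul_pos h0 (mul_pos h0 h2)], by nlinarith, ?_⟩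
    rw [p_zero, p_zero, q_zero, q_zero]
    simp
  | succ n ih =>
    intro α hα
    have h1 := one_lt_inv_fract hα
    have h0 : 0 < Int.fract α := inv_pos.1 (by linarith)
    obtain ⟨i1, i2, i3⟩ := ih (irrational_inv_fract hα)
    obtain ⟨e1, e2⟩ := p_q_succ hα n
    obtain ⟨e3, e4⟩ := p_q_succ hα (n + 1)
    rw [returnDist_succ hα n, returnDist_succ hα (n + 1), abs_neg, abs_neg, abs_mul, abs_mul,
      abs_of_pos h0, e1, e2, e3, e4]
    refine ⟨by nlinarith [mul_pos h0 h0], by nlinarith, ?_⟩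
    rw [← abs_neg, ← i3]
    congr 1
    ring

variable {α : ℝ}

lemma abs_returnDist_pos (hα : Irrational α) (n : ℕ) : 0 < |returnDist α n| :=
  (abs_nonneg _).trans_lt (returnDist_step n hα).2.1

lemma abs_returnDist_strictAnti (hα : Irrational α) : StrictAnti fun n => |returnDist α n| :=
  strictAnti_nat_of_succ_lt fun n => (returnDist_step n hα).2.1

/-- Best approximation: among the first `q_{n+1} - 1` iterates of a point under the rotation by
`α`, the `q_n`-th one is closest to the point. -/
lemma abs_returnDist_le (hα : Irrational α) (n : ℕ) {j : ℕ} (hj : 0 < j)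
    (hjq : j < q α (n + 1)) (k : ℤ) : |returnDist α n| ≤ |j * α - k| := by
  obtain ⟨h1, h2, h3⟩ := returnDist_step n hα
  set P := p α n
  set P' := p α (n + 1)
  have hQ : (0 : ℤ) < q α n := by exact_mod_cast q_pos α n
  have hQ' : (0 : ℤ) < q α (n + 1) := by exact_mod_cast q_pos α (n + 1)
  -- Since the determinant is `±1`, `(j, k)` is an integral combination of the two convergents.
  obtain ⟨u, v, hu, hv⟩ : ∃ u v : ℤ, (j : ℤ) = u * q α n + v * q α (n + 1) ∧
      k = u * P + v * P' := by
    rcases (abs_eq zero_le_one).1 h3 with h | h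
    · refine ⟨j * P' - k * q α (n + 1), k * q α n - j * P, ?_, ?_⟩
      · linear_combination -(j : ℤ) * h
      · linear_combination -k * h
    · refine ⟨-(j * P' - k * q α (n + 1)), -(k * q α n - j * P), ?_, ?_⟩
      · linear_combination (j : ℤ) * h
      · linear_combination k * h
  have hval : (j : ℝ) * α - k = u * returnDist α n + v * returnDist α (n + 1) := by
    have hu' : (j : ℝ) = u * q α n + v * q α (n + 1) := by exact_mod_cast hu
    have hv' : (k : ℝ) = u * P + v * P' := by exact_mod_cast hv
    rw [hu', hv']
    simp only [returnDist]
    ring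
  have hj' : (0 : ℤ) < j := by exact_mod_cast hj
  have hjq' : (j : ℤ) < q α (n + 1) := by exact_mod_cast hjq
  have hu0 : u ≠ 0 := by
    rintro rfl
    have : 0 < v := by
      by_contra hv0
      nlinarith
    nlinarith
  have huv : u * v ≤ 0 := by
    by_contra hpos
    push Not at hpos
    rcases lt_or_gt_of_ne hu0 with hneg | hpos'
    · have : v < 0 := by
        by_contra hv0
        nlinarith
      nlinarith
    · have : 0 < v := by
        by_contra hv0
        nlinarith
      nlinarith
  have hu1 : (1 : ℝ) ≤ |(u : ℝ)| := by exact_mod_cast Int.one_le_abs hu0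
  have hsign : 0 ≤ (u * returnDist α n) * (v * returnDist α (n + 1)) := by
    have : ((u * v : ℤ) : ℝ) ≤ 0 := by exact_mod_cast huv
    push_cast at this
    nlinarith
  have hsum : |(u : ℝ) * returnDist α n| ≤ |u * returnDist α n + v * returnDist α (n + 1)| := by
    rw [abs_add_eq_add_abs_iff _ _ |>.2 (mul_nonneg_iff.1 hsign)]
    linarith [abs_nonneg ((v : ℝ) * returnDist α (n + 1))]
  rw [hval]
  refine le_trans ?_ hsum
  rw [abs_mul]
  nlinarith [abs_nonneg (returnDist α n)]

lemma q_le_q_succ (hα : Irrational α) (n : ℕ) : q α n ≤ q α (n + 1) := by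
  cases n with
  | zero => rw [q_zero]; exact q_pos _ _
  | succ n =>
    by_contra h
    push Not at h
    have h1 := abs_returnDist_le hα n (q_pos α (n + 2)) h (p α (n + 2))
    have h2 := abs_returnDist_strictAnti hα (show n < n + 2 by omega)
    exact absurd h1 (not_le.2 h2)

lemma q_mul_abs_returnDist (hα : Irrational α) (n : ℕ) :
    q α (n + 1) * |returnDist α n| + q α n * |returnDist α (n + 1)| = 1 := by
  obtain ⟨h1, h2, h3⟩ := returnDist_step n hα
  have hdet : q α (n + 1) * returnDist α n - q α n * returnDist α (n + 1) =
      ((p α (n + 1) * q α n - p α n * q α (n + 1) : ℤ) : ℝ) := by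
    push_cast
    simp only [returnDist]
    ring
  have hb := congrArg (fun t : ℝ => |t|) hdet
  have hc : |((p α (n + 1) * q α n - p α n * q α (n + 1) : ℤ) : ℝ)| = 1 := by
    exact_mod_cast h3
  simp only [hc] at hb
  have hQ : (0 : ℝ) < q α n := by exact_mod_cast q_pos α n
  have hQ' : (0 : ℝ) < q α (n + 1) := by exact_mod_cast q_pos α (n + 1)
  rw [sub_eq_add_neg, (abs_add_eq_add_abs_iff _ _).2, abs_neg, abs_mul, abs_mul, abs_of_pos hQ,
    abs_of_pos hQ'] at hb
  · exact hb
  · rcases mul_neg_iff.1 h1 with ⟨ha, hb⟩ | ⟨ha, hb⟩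
    · left; constructor <;> nlinarith
    · right; constructor <;> nlinarith

lemma abs_returnDist_le_inv (hα : Irrational α) (n : ℕ) :
    |returnDist α n| ≤ 1 / q α (n + 1) := by
  have h := q_mul_abs_returnDist hα n
  have hQ' : (0 : ℝ) < q α (n + 1) := by exact_mod_cast q_pos α (n + 1)
  rw [le_div_iff₀ hQ']
  nlinarith [abs_nonneg (returnDist α (n + 1)), Nat.cast_nonneg (α := ℝ) (q α n)]

lemma inv_le_abs_returnDist (hα : Irrational α) (n : ℕ) :
    1 / (2 * q α (n + 1)) ≤ |returnDist α n| := by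
  have h := q_mul_abs_returnDist hα n
  have hQ' : (0 : ℝ) < q α (n + 1) := by exact_mod_cast q_pos α (n + 1)
  have h1 : (q α n : ℝ) ≤ q α (n + 1) := by exact_mod_cast q_le_q_succ hα n
  have h2 := (returnDist_step n hα).2.1
  rw [div_le_iff₀ (by positivity)]
  nlinarith [abs_nonneg (returnDist α (n + 1)), Nat.cast_nonneg (α := ℝ) (q α n)]

lemma q_lt_q_add_two (hα : Irrational α) (n : ℕ) : q α n < q α (n + 2) := by
  have h1 := q_le_q_succ hα n
  have h2 := q_le_q_succ hα (n + 1)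
  rcases (h1.trans h2).lt_or_eq with h | h
  · exact h
  exfalso
  -- Equal denominators would make two return distances of the same sign differ by an integer.
  obtain ⟨s1, d1, -⟩ := returnDist_step n hα
  obtain ⟨s2, d2, -⟩ := returnDist_step (n + 1) hα
  have hle : |returnDist α n| ≤ 1 := by
    refine (abs_returnDist_le_inv hα n).trans ?_
    rw [div_le_one (by exact_mod_cast q_pos α (n + 1))]
    exact_mod_cast q_pos α (n + 1)
  have hint : returnDist α n - returnDist α (n + 2) = ((p α (n + 2) - p α n : ℤ) : ℝ) := by
    simp only [returnDist, h]
    push_cast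
    ring
  have hpos := abs_returnDist_pos hα (n + 2)
  have habs : |returnDist α n - returnDist α (n + 2)| < 1 ∧
      returnDist α n ≠ returnDist α (n + 2) := by
    have hd : |returnDist α (n + 2)| < |returnDist α n| := d2.trans d1
    refine ⟨?_, fun h => by rw [h] at hd; exact lt_irrefl _ hd⟩
    rcases mul_neg_iff.1 s1 with ⟨ha, hb⟩ | ⟨ha, hb⟩ <;>
      rcases mul_neg_iff.1 s2 with ⟨hc, hd⟩ | ⟨hc, hd⟩
    · linarith
    · rw [abs_of_pos ha] at hle d1
      rw [abs_of_pos hd] at hpos d2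
      rw [abs_lt]; constructor <;> linarith
    · rw [abs_of_neg ha] at hle d1
      rw [abs_of_neg hd] at hpos d2
      rw [abs_lt]; constructor <;> linarith
    · linarith
  rw [hint] at habs
  have h0 : p α (n + 2) - p α n = 0 := Int.abs_lt_one_iff.1 (by exact_mod_cast habs.1)
  rw [h0] at hint
  exact habs.2 (by simpa [sub_eq_zero] using hint)

lemma tendsto_q (hα : Irrational α) : Filter.Tendsto (q α) Filter.atTop Filter.atTop := by
  have hmono : Monotone (q α) := monotone_nat_of_le_succ (q_le_q_succ hα)
  have hq : ∀ n, n ≤ q α (2 * n) := by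
    intro n
    induction n with
    | zero => simp
    | succ n ih => have := q_lt_q_add_two hα (2 * n); exact Nat.succ_le_of_lt (ih.trans_lt this)
  exact Filter.tendsto_atTop_atTop.2 fun b => ⟨2 * b, fun n hn => (hq b).trans (hmono hn)⟩

lemma tendsto_returnDist (hα : Irrational α) :
    Filter.Tendsto (fun n => |returnDist α n|) Filter.atTop (nhds 0) := by
  have h1 : Filter.Tendsto (fun n => (1 : ℝ) / q α (n + 1)) Filter.atTop (nhds 0) := by
    simp only [one_div]
    exact (tendsto_inv_atTop_zero.comp (tendsto_natCast_atTop_atTop.comp (tendsto_q hα))).comp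
      (Filter.tendsto_add_atTop_nat 1)
  exact squeeze_zero (fun n => abs_nonneg _) (abs_returnDist_le_inv hα) h1

/-- What is used about the rotation by `α` at the scale `a`: its first `Q` iterates are
`a`-separated, `2a`-dense, and the `Q`-th iterate returns `a`-close to the starting point. -/
structure RotationScale (α a : ℝ) (Q : ℕ) : Prop where
  pos : 0 < a
  le_one : a ≤ 1
  separated : ∀ j : ℕ, 0 < j → j < Q → ∀ k : ℤ, a ≤ |j * α - k|
  cover : ∀ t : ℝ, ∃ l < Q, ∃ k : ℤ, |t - l * α - k| ≤ 2 * a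
  returns : ∃ P : ℤ, |Q * α - P| ≤ a

/-- Close to the multiple `l α` lies the rational `l p_n / q_n`, and the numbers `l p_n / q_n` are
equidistributed modulo `1` because `p_n` is invertible modulo `q_n`. -/
lemma rotationScale (hα : Irrational α) (n : ℕ) :
    RotationScale α |returnDist α n| (q α (n + 1)) := by
  have hQ : 0 < q α (n + 1) := q_pos α (n + 1)
  have hQr : (0 : ℝ) < q α (n + 1) := by exact_mod_cast hQ
  have hret : |returnDist α (n + 1)| ≤ |returnDist α n| := (returnDist_step n hα).2.1.le
  refine ⟨abs_returnDist_pos hα n, ?_, fun j hj hjq k => abs_returnDist_le hα n hj hjq k, ?_,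
    ⟨p α (n + 1), hret⟩⟩
  · refine (abs_returnDist_le_inv hα n).trans ?_
    rw [div_le_one hQr]
    exact_mod_cast hQ
  intro t
  set Q := q α (n + 1)
  set P := p α (n + 1)
  have hcop : IsCoprime P (Q : ℤ) := by
    rw [Int.isCoprime_iff_nat_coprime]
    exact (α.convergent (n + 1)).reduced
  obtain ⟨b, c, hbc⟩ := hcop
  set r := round (t * Q)
  have hQz : (0 : ℤ) < Q := by exact_mod_cast hQ
  obtain ⟨l, hl⟩ := Int.eq_ofNat_of_zero_le (Int.emod_nonneg (r * b) hQz.ne')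
  have hlQ : l < Q := by
    have := Int.emod_lt_of_pos (r * b) hQz
    rw [hl] at this
    exact_mod_cast this
  set k := r * c + (r * b / Q) * P
  have hlk : (l : ℤ) * P = r - k * Q := by
    have := Int.emod_add_mul_ediv (r * b) Q
    rw [hl] at this
    linear_combination P * this + r * hbc
  refine ⟨l, hlQ, k, ?_⟩
  have hlk' : (l : ℝ) * P = r - k * Q := by exact_mod_cast hlk
  have hround : |t * Q - r| ≤ 1 / 2 := abs_sub_round _
  have hident : (t - l * α - k) * Q = (t * Q - r) - l * returnDist α (n + 1) := by
    change (t - l * α - k) * Q = (t * Q - r) - l * (Q * α - P)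
    linear_combination -hlk'
  have hl' : (l : ℝ) ≤ Q := by exact_mod_cast hlQ.le
  have hbound : |t - l * α - k| * Q ≤ 1 / 2 + Q * |returnDist α n| := by
    rw [← abs_of_pos hQr, ← abs_mul, abs_of_pos hQr, hident]
    refine (abs_sub _ _).trans (add_le_add hround ?_)
    rw [abs_mul, Nat.abs_cast]
    exact mul_le_mul hl' hret (abs_nonneg _) hQr.le
  have h2 := inv_le_abs_returnDist hα n
  rw [div_le_iff₀ (by positivity)] at h2
  refine le_of_mul_le_mul_right ?_ hQr
  change 1 ≤ |returnDist α n| * (2 * Q) at h2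
  linarith

/-! ### Disjoint intervals on the circle and distortion -/

/-- Intervals of length at most `1` whose integer translates have disjoint interiors have total
length at most `2`: translated so as to start in `[0, 1)`, they lie in `[0, 2]`. -/
lemma sum_length_le_two {ι : Type*} (s : Finset ι) (x y : ι → ℝ) (hxy : ∀ i ∈ s, x i ≤ y i)
    (hy : ∀ i ∈ s, y i ≤ x i + 1)
    (hd : ∀ i ∈ s, ∀ j ∈ s, i ≠ j → ∀ k : ℤ, y i ≤ x j + k ∨ y j + k ≤ x i) :
    ∑ i ∈ s, (y i - x i) ≤ 2 := by
  classical
  let I : ι → Set ℝ := fun i => Set.Ioo (x i - ⌊x i⌋) (y i - ⌊x i⌋)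
  have hdisj : (s : Set ι).PairwiseDisjoint I := by
    intro i hi j hj hij
    rw [Function.onFun, Set.disjoint_left]
    rintro t ⟨h1, h2⟩ ⟨h3, h4⟩
    rcases hd i hi j hj hij (⌊x i⌋ - ⌊x j⌋) with h | h <;> push_cast at h <;> linarith
  have hsub : ⋃ i ∈ s, I i ⊆ Set.Icc 0 2 := by
    refine Set.iUnion₂_subset fun i hi t ht => ?_
    have h1 := Int.floor_le (x i)
    have h2 := Int.lt_floor_add_one (x i)
    have h3 := hy i hi
    constructor <;> linarith [ht.1, ht.2]
  have hvol : ∑ i ∈ s, MeasureTheory.volume (I i) ≤ MeasureTheory.volume (Set.Icc (0 : ℝ) 2) := by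
    rw [← MeasureTheory.measure_biUnion_finset hdisj fun i _ => measurableSet_Ioo]
    exact MeasureTheory.measure_mono hsub
  have hval : ∑ i ∈ s, MeasureTheory.volume (I i) = ENNReal.ofReal (∑ i ∈ s, (y i - x i)) := by
    rw [ENNReal.ofReal_sum_of_nonneg fun i hi => sub_nonneg.2 (hxy i hi)]
    refine Finset.sum_congr rfl fun i _ => ?_
    rw [Real.volume_Ioo]
    congr 1
    ring
  rw [hval, Real.volume_Icc] at hvol
  have := (ENNReal.ofReal_le_ofReal_iff (by norm_num)).1 hvol
  linarith

/-- `G` is the lift of a circle diffeomorphism with derivative `D`, nonlinearity `N = D' / D` and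
Schwarzian derivative `σ = N' - N² / 2`, the latter two bounded by `B`. -/
structure SmoothLift (G D N σ : ℝ → ℝ) (B : ℝ) : Prop where
  hasDerivAt : ∀ x, HasDerivAt G (D x) x
  pos : ∀ x, 0 < D x
  hasDerivAt_deriv : ∀ x, HasDerivAt D (D x * N x) x
  hasDerivAt_nonlin : ∀ x, HasDerivAt N (σ x + N x ^ 2 / 2) x
  nonlin_le : ∀ x, |N x| ≤ B
  schwarz_le : ∀ x, |σ x| ≤ B
  add_one : ∀ x, G (x + 1) = G x + 1
  deriv_add_one : ∀ x, D (x + 1) = D x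
  nonlin_add_one : ∀ x, N (x + 1) = N x

/-- The derivative of `G^j`, as a product along the orbit. -/
def derivIter (G D : ℝ → ℝ) (j : ℕ) (x : ℝ) : ℝ := ∏ i ∈ Finset.range j, D (G^[i] x)

/-- The nonlinearity of `G^j`, that is the logarithmic derivative of `derivIter G D j`. -/
def nonlinIter (G D N : ℝ → ℝ) (j : ℕ) (x : ℝ) : ℝ :=
  ∑ i ∈ Finset.range j, N (G^[i] x) * derivIter G D i x

lemma derivIter_succ (G D : ℝ → ℝ) (j : ℕ) (x : ℝ) :
    derivIter G D (j + 1) x = derivIter G D j x * D (G^[j] x) := Finset.prod_range_succ _ _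

lemma nonlinIter_succ (G D N : ℝ → ℝ) (j : ℕ) (x : ℝ) : nonlinIter G D N (j + 1) x =
    nonlinIter G D N j x + N (G^[j] x) * derivIter G D j x := Finset.sum_range_succ _ _

lemma derivIter_add (G D : ℝ → ℝ) (i j : ℕ) (x : ℝ) :
    derivIter G D (i + j) x = derivIter G D i x * derivIter G D j (G^[i] x) := by
  simp only [derivIter, Finset.prod_range_add, ← Function.iterate_add_apply, add_comm]

lemma nonlinIter_add (G D N : ℝ → ℝ) (i j : ℕ) (x : ℝ) : nonlinIter G D N (i + j) x =
    nonlinIter G D N i x + derivIter G D i x * nonlinIter G D N j (G^[i] x) := by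
  induction j with
  | zero => simp [nonlinIter]
  | succ j ih =>
    rw [← add_assoc, nonlinIter_succ, ih, nonlinIter_succ, derivIter_add,
      add_comm i j, Function.iterate_add_apply]
    ring

lemma tendsto_atTop_atBot_of_map_add_int {f : ℝ → ℝ} (hf : Monotone f)
    (h1 : ∀ (x : ℝ) (k : ℤ), f (x + k) = f x + k) :
    Filter.Tendsto f Filter.atTop Filter.atTop ∧ Filter.Tendsto f Filter.atBot Filter.atBot := by
  constructor
  · refine Filter.tendsto_atTop_atTop.2 fun b => ⟨(⌈b - f 0⌉ : ℤ), fun x hx => ?_⟩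
    have h2 := hf hx
    have h3 := h1 0 ⌈b - f 0⌉
    rw [zero_add] at h3
    linarith [Int.le_ceil (b - f 0)]
  · refine Filter.tendsto_atBot_atBot.2 fun b => ⟨(⌊b - f 0⌋ : ℤ), fun x hx => ?_⟩
    have h2 := hf hx
    have h3 := h1 0 ⌊b - f 0⌋
    rw [zero_add] at h3
    linarith [Int.floor_le (b - f 0)]

namespace SmoothLift

variable {G D N σ : ℝ → ℝ} {B : ℝ}

lemma strictMono (hG : SmoothLift G D N σ B) : StrictMono G :=
  strictMono_of_deriv_pos fun x => by rw [(hG.hasDerivAt x).deriv]; exact hG.pos x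

lemma bound_nonneg (hG : SmoothLift G D N σ B) : 0 ≤ B := (abs_nonneg _).trans (hG.nonlin_le 0)

lemma derivIter_pos (hG : SmoothLift G D N σ B) (j : ℕ) (x : ℝ) : 0 < derivIter G D j x :=
  Finset.prod_pos fun _ _ => hG.pos _

lemma hasDerivAt_iterate (hG : SmoothLift G D N σ B) (j : ℕ) (x : ℝ) :
    HasDerivAt G^[j] (derivIter G D j x) x := by
  induction j with
  | zero => simpa [derivIter] using hasDerivAt_id x
  | succ j ih =>
    rw [derivIter_succ, mul_comm, Function.iterate_succ']
    exact (hG.hasDerivAt _).comp x ih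

lemma hasDerivAt_derivIter (hG : SmoothLift G D N σ B) (j : ℕ) (x : ℝ) :
    HasDerivAt (derivIter G D j) (derivIter G D j x * nonlinIter G D N j x) x := by
  induction j with
  | zero =>
    have h : derivIter G D 0 = fun _ => 1 := funext fun y => by simp [derivIter]
    rw [h]
    simpa [nonlinIter] using hasDerivAt_const x (1 : ℝ)
  | succ j ih =>
    have h1 := ih.mul ((hG.hasDerivAt_deriv (G^[j] x)).comp x (hG.hasDerivAt_iterate j x))
    have h2 : derivIter G D (j + 1) = derivIter G D j * (D ∘ G^[j]) :=
      funext fun y => derivIter_succ G D j y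
    rw [h2]
    refine h1.congr_deriv ?_
    simp only [Pi.mul_apply, Function.comp_apply, nonlinIter_succ]
    ring

/-- The chain rule for the Schwarzian derivative. -/
lemma hasDerivAt_nonlinIter (hG : SmoothLift G D N σ B) (j : ℕ) (x : ℝ) :
    HasDerivAt (nonlinIter G D N j) (nonlinIter G D N j x ^ 2 / 2 +
      ∑ i ∈ Finset.range j, σ (G^[i] x) * derivIter G D i x ^ 2) x := by
  induction j with
  | zero =>
    have h : nonlinIter G D N 0 = fun _ => 0 := funext fun y => by simp [nonlinIter]
    rw [h]
    simpa using hasDerivAt_const x (0 : ℝ)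
  | succ j ih =>
    have h1 := ih.add (((hG.hasDerivAt_nonlin (G^[j] x)).comp x
      (hG.hasDerivAt_iterate j x)).mul (hG.hasDerivAt_derivIter j x))
    have h2 : nonlinIter G D N (j + 1) =
        nonlinIter G D N j + (N ∘ G^[j]) * derivIter G D j :=
      funext fun y => nonlinIter_succ G D N j y
    rw [h2]
    refine h1.congr_deriv ?_
    simp only [Pi.mul_apply, Pi.add_apply, Function.comp_apply, Finset.sum_range_succ]
    ring

lemma iterate_add_int (hG : SmoothLift G D N σ B) (j : ℕ) (x : ℝ) (k : ℤ) :
    G^[j] (x + k) = G^[j] x + k := by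
  have h1 : Function.Commute G (fun x => x + 1) := hG.add_one
  have h2 : Function.Commute G (fun x => x - 1) := fun x => by
    have := hG.add_one (x - 1)
    rw [sub_add_cancel] at this
    change G (x - 1) = G x - 1
    linarith
  have h3 : ∀ (n : ℕ) (x : ℝ), (fun x : ℝ => x + 1)^[n] x = x + n := by
    intro n x; simp
  have h4 : ∀ (n : ℕ) (x : ℝ), (fun x : ℝ => x - 1)^[n] x = x - n := by
    intro n x
    induction n with
    | zero => simp
    | succ n ih => rw [Function.iterate_succ_apply', ih]; push_cast; ring
  obtain ⟨n, rfl | rfl⟩ := k.eq_nat_or_neg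
  · have := (h1.iterate_iterate j n).eq x
    rw [h3, h3] at this
    simpa using this
  · have := (h2.iterate_iterate j n).eq x
    rw [h4, h4] at this
    simpa [sub_eq_add_neg] using this

lemma derivIter_add_int (hG : SmoothLift G D N σ B) (j : ℕ) (x : ℝ) (k : ℤ) :
    derivIter G D j (x + k) = derivIter G D j x := by
  refine Finset.prod_congr rfl fun i _ => ?_
  rw [hG.iterate_add_int]
  simpa using (Function.Periodic.int_mul (f := D) (c := 1) hG.deriv_add_one k) (G^[i] x)

lemma nonlinIter_add_int (hG : SmoothLift G D N σ B) (j : ℕ) (x : ℝ) (k : ℤ) :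
    nonlinIter G D N j (x + k) = nonlinIter G D N j x := by
  refine Finset.sum_congr rfl fun i _ => ?_
  rw [hG.iterate_add_int, hG.derivIter_add_int]
  congr 1
  simpa using (Function.Periodic.int_mul (f := N) (c := 1) hG.nonlin_add_one k) (G^[i] x)

lemma abs_log_deriv_sub_le (hG : SmoothLift G D N σ B) (x y : ℝ) :
    |Real.log (D x) - Real.log (D y)| ≤ B * |x - y| := by
  have h : ∀ x, HasDerivAt (fun x => Real.log (D x)) (N x) x := fun x => by
    convert (hG.hasDerivAt_deriv x).log (hG.pos x).ne' using 1
    rw [mul_div_cancel_left₀ _ (hG.pos x).ne']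
  have := convex_univ.norm_image_sub_le_of_norm_hasDerivWithin_le
    (f := fun x => Real.log (D x)) (f' := N) (C := B)
    (fun x _ => (h x).hasDerivWithinAt) (fun x _ => hG.nonlin_le x) (Set.mem_univ y)
    (Set.mem_univ x)
  simpa [Real.norm_eq_abs] using this

lemma log_derivIter (hG : SmoothLift G D N σ B) (j : ℕ) (x : ℝ) :
    Real.log (derivIter G D j x) = ∑ i ∈ Finset.range j, Real.log (D (G^[i] x)) :=
  Real.log_prod fun _ _ => (hG.pos _).ne'

lemma abs_log_derivIter_sub_le (hG : SmoothLift G D N σ B) (j : ℕ) (x y : ℝ) :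
    |Real.log (derivIter G D j x) - Real.log (derivIter G D j y)| ≤
      B * ∑ i ∈ Finset.range j, |G^[i] x - G^[i] y| := by
  rw [hG.log_derivIter, hG.log_derivIter, ← Finset.sum_sub_distrib, Finset.mul_sum]
  exact (Finset.abs_sum_le_sum_abs _ _).trans
    (Finset.sum_le_sum fun i _ => hG.abs_log_deriv_sub_le _ _)

lemma continuous (hG : SmoothLift G D N σ B) : Continuous G :=
  continuous_iff_continuousAt.2 fun x => (hG.hasDerivAt x).continuousAt

lemma surjective (hG : SmoothLift G D N σ B) : Function.Surjective G := by
  have := tendsto_atTop_atBot_of_map_add_int hG.strictMono.monotone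
    (fun x k => hG.iterate_add_int 1 x k)
  exact hG.continuous.surjective this.1 this.2

/-- The mean value theorem for an iterate. -/
lemma exists_derivIter_eq (hG : SmoothLift G D N σ B) (j : ℕ) {u v : ℝ} (huv : u ≤ v) :
    ∃ ξ ∈ Set.Icc u v, G^[j] v - G^[j] u = derivIter G D j ξ * (v - u) := by
  rcases huv.eq_or_lt with rfl | h
  · exact ⟨u, by simp, by simp⟩
  · obtain ⟨ξ, hξ, h'⟩ := exists_hasDerivAt_eq_slope G^[j] (derivIter G D j) h
      (fun x _ => (hG.hasDerivAt_iterate j x).continuousAt.continuousWithinAt)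
      (fun x _ => hG.hasDerivAt_iterate j x)
    refine ⟨ξ, Set.Ioo_subset_Icc_self hξ, ?_⟩
    rw [h', div_mul_cancel₀ _ (sub_pos.2 h).ne']

end SmoothLift

section Semiconjugacy

variable {G D N σ F : ℝ → ℝ} {B α : ℝ}

lemma semiconj_iterate (hF : ∀ x, F (G x) = F x + α) (j : ℕ) (x : ℝ) :
    F (G^[j] x) = F x + j * α := by
  induction j with
  | zero => simp
  | succ j ih =>
    rw [Function.iterate_succ_apply', hF, ih]
    push_cast
    ring

/-- Iterates of an interval have total length at most `2` as long as they are disjoint modulo `1`,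
which can be read off from the semiconjugacy `F` to the rotation by `α`. -/
lemma sum_iterate_length_le_two (hG : SmoothLift G D N σ B) (hFm : Monotone F)
    (hF : ∀ x, F (G x) = F x + α) (hF1 : ∀ (x : ℝ) (k : ℤ), F (x + k) = F x + k) (Q : ℕ) {u v : ℝ}
    (huv : u ≤ v) (hv : v ≤ u + 1)
    (hsep : (∀ j : ℕ, 0 < j → j < Q → ∀ k : ℤ, F v - F u < |j * α - k|) ∨
      (StrictMono F ∧ ∀ j : ℕ, 0 < j → j < Q → ∀ k : ℤ, F v - F u ≤ |j * α - k|)) :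
    ∑ j ∈ Finset.range Q, (G^[j] v - G^[j] u) ≤ 2 := by
  have hmono : ∀ j, Monotone G^[j] := fun j => hG.strictMono.monotone.iterate j
  refine sum_length_le_two _ _ _ (fun j _ => hmono j huv) (fun j _ => ?_) ?_
  · have := hG.iterate_add_int j u 1
    push_cast at this
    rw [← this]
    exact hmono j hv
  intro i hi j hj hij k
  rw [Finset.mem_range] at hi hj
  have hcmp : ∀ d : ℝ, (∃ (l : ℕ) (k : ℤ), 0 < l ∧ l < Q ∧ |d| = |l * α - k|) → ∀ y z : ℝ,
      F z - F y = |d| - (F v - F u) → y ≤ z := by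
    rintro d ⟨l, k, hl, hlQ, hd⟩ y z hyz
    rcases hsep with h | ⟨hs, h⟩
    · have := h l hl hlQ k
      exact (hFm.reflect_lt (by linarith)).le
    · have := h l hl hlQ k
      exact hs.le_iff_le.1 (by linarith)
  have hd : ∃ (l : ℕ) (k' : ℤ), 0 < l ∧ l < Q ∧
      |(j : ℝ) * α + k - i * α| = |l * α - k'| := by
    rcases lt_or_gt_of_ne hij with h | h
    · refine ⟨j - i, -k, by omega, by omega, ?_⟩
      rw [Nat.cast_sub h.le]
      push_cast
      congr 1
      ring
    · refine ⟨i - j, k, by omega, by omega, ?_⟩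
      rw [Nat.cast_sub h.le, ← abs_neg]
      congr 1
      ring
  rcases le_total 0 ((j : ℝ) * α + k - i * α) with h0 | h0
  · left
    refine hcmp _ hd _ _ ?_
    rw [hF1, semiconj_iterate hF, semiconj_iterate hF, abs_of_nonneg h0]
    ring
  · right
    refine hcmp _ hd _ _ ?_
    rw [hF1, semiconj_iterate hF, semiconj_iterate hF, abs_of_nonpos h0]
    ring

/-- The key step of Denjoy's theorem: a monotone semiconjugacy to an irrational rotation has no
interval of constancy. -/
lemma strictMono_of_semiconj (hG : SmoothLift G D N σ B) (hα : Irrational α) (hFm : Monotone F)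
    (hF : ∀ x, F (G x) = F x + α) (hF1 : ∀ (x : ℝ) (k : ℤ), F (x + k) = F x + k) :
    StrictMono F := by
  refine hFm.strictMono_of_injective ?_
  have hlen : ∀ {u v : ℝ}, F v < F u + 1 → v ≤ u + 1 := fun {u v} h => by
    have h1 := hF1 u 1
    push_cast at h1
    exact (hFm.reflect_lt (by rw [h1]; exact h)).le
  suffices key : ∀ u v : ℝ, u < v → F u ≠ F v by
    intro u v h
    rcases lt_trichotomy u v with h' | h' | h'
    · exact absurd h (key u v h')
    · exact h'
    · exact absurd h.symm (key v u h')
  intro u v huv hFuv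
  have hmono : ∀ j, Monotone G^[j] := fun j => hG.strictMono.monotone.iterate j
  -- The iterates of a wandering interval are disjoint, so that their lengths tend to `0`.
  have hsum : Summable fun j => G^[j] v - G^[j] u := by
    refine summable_of_sum_range_le (c := 2) (fun j => sub_nonneg.2 (hmono j huv.le)) fun Q => ?_
    refine sum_iterate_length_le_two hG hFm hF hF1 Q huv.le (hlen (by rw [hFuv]; linarith))
      (Or.inl fun j hj _ k => ?_)
    rw [hFuv, sub_self, abs_pos, sub_ne_zero]
    intro h
    have hj' : (j : ℝ) ≠ 0 := by exact_mod_cast hj.ne'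
    exact hα ⟨k / j, by push_cast; rw [← h]; field_simp⟩
  have hlim := hsum.tendsto_atTop_zero.comp (tendsto_q hα)
  -- Along closest return times they stay bounded below.
  have hlow : ∀ n : ℕ, (v - u) ^ 2 * Real.exp (-(B * 2)) ≤
      G^[q α (n + 1)] v - G^[q α (n + 1)] u := by
    intro n
    set Q := q α (n + 1)
    obtain ⟨u', hu'⟩ := (hG.surjective.iterate Q) (u + p α (n + 1))
    obtain ⟨v', hv'⟩ := (hG.surjective.iterate Q) (v + p α (n + 1))
    have huv' : u' ≤ v' :=
      (hG.strictMono.iterate Q).le_iff_le.1 (by rw [hu', hv']; linarith)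
    have hFu' : F u' = F u - returnDist α (n + 1) := by
      have := semiconj_iterate hF Q u'
      rw [hu', hF1] at this
      change _ = _ - (Q * α - p α (n + 1))
      linarith
    have hFv' : F v' = F u - returnDist α (n + 1) := by
      have := semiconj_iterate hF Q v'
      rw [hv', hF1, ← hFuv] at this
      change _ = _ - (Q * α - p α (n + 1))
      linarith
    obtain ⟨w, hw, hwe⟩ := hG.exists_derivIter_eq Q huv.le
    obtain ⟨w', hw', hwe'⟩ := hG.exists_derivIter_eq Q huv'
    have hFw : F w = F u := le_antisymm (by rw [hFuv]; exact hFm hw.2) (hFm hw.1)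
    have hFw' : F w' = F u - returnDist α (n + 1) :=
      le_antisymm (by rw [← hFv']; exact hFm hw'.2) (by rw [← hFu']; exact hFm hw'.1)
    have hlt := (returnDist_step n hα).2.1
    have hR := rotationScale hα n
    have hdist : ∑ i ∈ Finset.range Q, |G^[i] w - G^[i] w'| ≤ 2 := by
      have haux : ∀ s t : ℝ, s ≤ t → F t - F s = |returnDist α (n + 1)| →
          ∑ i ∈ Finset.range Q, (G^[i] t - G^[i] s) ≤ 2 := by
        intro s t hst hFst
        refine sum_iterate_length_le_two hG hFm hF hF1 Q hst
          (hlen (by linarith [hR.le_one])) (Or.inl fun j hj hjQ k => ?_)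
        rw [hFst]
        exact hlt.trans_le (hR.separated j hj hjQ k)
      rcases le_total w w' with h | h
      · refine le_of_eq_of_le (Finset.sum_congr rfl fun i _ => ?_) (haux w w' h ?_)
        · rw [abs_sub_comm, abs_of_nonneg (sub_nonneg.2 (hmono i h))]
        · have := hFm h
          rw [hFw, hFw'] at this ⊢
          rw [abs_of_nonpos (by linarith)]
          ring
      · refine le_of_eq_of_le (Finset.sum_congr rfl fun i _ => ?_) (haux w' w h ?_)
        · rw [abs_of_nonneg (sub_nonneg.2 (hmono i h))]
        · have := hFm h
          rw [hFw, hFw'] at this ⊢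
          rw [abs_of_nonneg (by linarith)]
          ring
    have hlog := hG.abs_log_derivIter_sub_le Q w w'
    have hB := hG.bound_nonneg
    have hratio : derivIter G D Q w' * Real.exp (-(B * 2)) ≤ derivIter G D Q w := by
      have h1 := hG.derivIter_pos Q w
      have h2 := hG.derivIter_pos Q w'
      rw [← Real.exp_log h1, ← Real.exp_log h2, ← Real.exp_add]
      refine Real.exp_le_exp.2 ?_
      have := (abs_le.1 (hlog.trans (mul_le_mul_of_nonneg_left hdist hB))).1
      linarith
    have hle1 : v' - u' ≤ 1 := by
      have := hlen (u := u') (v := v') (by rw [hFu', hFv']; linarith)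
      linarith
    have hpos' := hG.derivIter_pos Q w'
    rw [hu', hv'] at hwe'
    have hL : v - u ≤ derivIter G D Q w' := by nlinarith
    rw [hwe]
    have he := Real.exp_pos (-(B * 2))
    calc (v - u) ^ 2 * Real.exp (-(B * 2)) = ((v - u) * Real.exp (-(B * 2))) * (v - u) := by ring
      _ ≤ (derivIter G D Q w' * Real.exp (-(B * 2))) * (v - u) := by
          have := sub_pos.2 huv
          gcongr
      _ ≤ _ := by
          have := sub_pos.2 huv
          gcongr
  have hpos : 0 < (v - u) ^ 2 * Real.exp (-(B * 2)) :=
    mul_pos (pow_pos (sub_pos.2 huv) 2) (Real.exp_pos _)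
  have := ge_of_tendsto (hlim.comp (Filter.tendsto_add_atTop_nat 1))
    (Filter.Eventually.of_forall hlow)
  linarith

end Semiconjugacy

/-- Denjoy's theorem: a smooth circle diffeomorphism with irrational rotation number is conjugate
to a rotation. -/
theorem exists_isLinearization {G : CircleDeg1Lift} {D N σ : ℝ → ℝ} {B : ℝ}
    (hG : SmoothLift G D N σ B) (hα : Irrational G.translationNumber) :
    ∃ h : ℝ ≃o ℝ, IsLinearization G h := by
  set α := G.translationNumber with hαdef
  set T : CircleDeg1Lift := ↑(CircleDeg1Lift.translate (Multiplicative.ofAdd α))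
  have hT : Function.Bijective T := by
    rw [← CircleDeg1Lift.isUnit_iff_bijective]
    exact Units.isUnit _
  obtain ⟨F, hF⟩ := CircleDeg1Lift.semiconj_of_bijective_of_translationNumber_eq
    (f₁ := G) (f₂ := T) ⟨hG.strictMono.injective, hG.surjective⟩ hT
    (CircleDeg1Lift.translationNumber_translate α).symm
  have hF' : ∀ x, F (G x) = F x + α := fun x => by
    rw [hF x, CircleDeg1Lift.translate_apply, add_comm]
  have hF1 : ∀ (x : ℝ) (k : ℤ), F (x + k) = F x + k := fun x k => F.map_add_int x k
  have hdense : DenseRange F := by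
    rw [DenseRange, Metric.dense_iff]
    intro t r hr
    have hlim := (tendsto_returnDist hα).eventually (gt_mem_nhds (show 0 < r / 2 by positivity))
    obtain ⟨n, hn⟩ := hlim.exists
    obtain ⟨l, -, k, hlk⟩ := (rotationScale hα n).cover (t - F 0)
    refine ⟨_, ?_, ⟨G^[l] 0 + k, rfl⟩⟩
    rw [Metric.mem_ball, dist_comm, Real.dist_eq, hF1, semiconj_iterate hF']
    have : t - (F 0 + l * α + k) = t - F 0 - l * α - k := by ring
    rw [this]
    linarith
  have hcont : Continuous F := F.monotone.continuous_of_denseRange hdense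
  have hsurj : Function.Surjective F := by
    have := tendsto_atTop_atBot_of_map_add_int F.monotone hF1
    exact hcont.surjective this.1 this.2
  have hstrict : StrictMono F := strictMono_of_semiconj hG hα F.monotone hF' hF1
  set H : ℝ ≃o ℝ := hstrict.orderIsoOfSurjective F hsurj
  have hH : ∀ x, H x = F x := fun _ => rfl
  refine ⟨H.symm, fun x => ?_, fun x => ?_⟩
  · rw [OrderIso.symm_apply_eq, hH, F.map_add_one, ← hH, H.apply_symm_apply]
  · rw [OrderIso.symm_symm, hH, hF', ← hH, H.apply_symm_apply]

/-! ### Real estimates at a closest return -/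

/-- `H` is an increasing coordinate on the line, compatible with integer translations, in which the
smooth lift `G` is the translation by `α`. -/
structure LinearizedLift (G D N σ : ℝ → ℝ) (B : ℝ) (H : ℝ ≃o ℝ) (α : ℝ) : Prop where
  smooth : SmoothLift G D N σ B
  conj : ∀ x, H (G x) = H x + α
  add_int : ∀ (x : ℝ) (k : ℤ), H (x + k) = H x + k

/-- The translation by `θ` in the linearizing coordinate `H`. For `θ = q_n α - p_n` this is
`x ↦ G^{q_n}(x) - p_n`. -/
noncomputable def shift (H : ℝ ≃o ℝ) (θ x : ℝ) : ℝ := H.symm (H x + θ)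

/-- The displacement of `shift H θ`. -/
noncomputable def gap (H : ℝ ≃o ℝ) (θ x : ℝ) : ℝ := |shift H θ x - x|

@[simp] lemma apply_shift (H : ℝ ≃o ℝ) (θ x : ℝ) : H (shift H θ x) = H x + θ := by
  simp [shift]

lemma gap_pos (H : ℝ ≃o ℝ) {θ : ℝ} (hθ : θ ≠ 0) (x : ℝ) : 0 < gap H θ x := by
  refine abs_pos.2 fun h => hθ ?_
  have := congrArg H (sub_eq_zero.1 h)
  simpa using this

lemma continuous_gap (H : ℝ ≃o ℝ) (θ : ℝ) : Continuous (gap H θ) :=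
  ((H.symm.continuous.comp (H.continuous.add continuous_const)).sub continuous_id).abs

lemma le_exp_mul_of_abs_log_sub_le {s t b : ℝ} (hs : 0 < s) (ht : 0 < t)
    (h : |Real.log s - Real.log t| ≤ b) : s ≤ Real.exp b * t := by
  rw [← Real.exp_log hs, ← Real.exp_log ht, ← Real.exp_add]
  exact Real.exp_le_exp.2 (by linarith [(abs_le.1 h).2])

/-- A periodic continuous function attains its infimum. -/
lemma exists_forall_le_of_periodic {f : ℝ → ℝ} (hf : Continuous f)
    (hp : ∀ (x : ℝ) (k : ℤ), f (x + k) = f x) : ∃ x₀, ∀ x, f x₀ ≤ f x := by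
  obtain ⟨x₀, -, h⟩ := isCompact_Icc.exists_isMinOn (s := Set.Icc (0 : ℝ) 1)
    ⟨0, by simp⟩ hf.continuousOn
  refine ⟨x₀, fun x => ?_⟩
  have h1 := hp x (-⌊x⌋)
  rw [← h1]
  refine h ⟨?_, ?_⟩ <;> push_cast
  · linarith [Int.floor_le x]
  · linarith [Int.lt_floor_add_one x]

namespace LinearizedLift

variable {G D N σ : ℝ → ℝ} {B α a θ : ℝ} {H : ℝ ≃o ℝ} {Q : ℕ}

lemma apply_iterate (hL : LinearizedLift G D N σ B H α) (j : ℕ) (x : ℝ) :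
    H (G^[j] x) = H x + j * α := semiconj_iterate hL.conj j x

lemma shift_iterate (hL : LinearizedLift G D N σ B H α) (j : ℕ) (x : ℝ) :
    shift H θ (G^[j] x) = G^[j] (shift H θ x) := by
  apply H.injective
  rw [apply_shift, hL.apply_iterate, hL.apply_iterate, apply_shift]
  ring

lemma shift_add_int (hL : LinearizedLift G D N σ B H α) (x : ℝ) (k : ℤ) :
    shift H θ (x + k) = shift H θ x + k := by
  apply H.injective
  rw [apply_shift, hL.add_int, hL.add_int, apply_shift]
  ring

lemma gap_add_int (hL : LinearizedLift G D N σ B H α) (x : ℝ) (k : ℤ) :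
    gap H θ (x + k) = gap H θ x := by
  rw [gap, hL.shift_add_int, gap]
  congr 1
  ring

lemma gap_iterate (hL : LinearizedLift G D N σ B H α) (j : ℕ) (x : ℝ) :
    gap H θ (G^[j] x) = |G^[j] (shift H θ x) - G^[j] x| := by
  rw [gap, hL.shift_iterate]

/-- The first `Q` iterates of an interval of rotational length at most `a` have bounded total
length. -/
lemma sum_abs_iterate_sub_le (hL : LinearizedLift G D N σ B H α) (hR : RotationScale α a Q)
    {u v : ℝ} (huv : |H u - H v| ≤ a) :
    ∑ j ∈ Finset.range Q, |G^[j] u - G^[j] v| ≤ 2 := by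
  have aux : ∀ s t : ℝ, s ≤ t → |H t - H s| ≤ a →
      ∑ j ∈ Finset.range Q, (G^[j] t - G^[j] s) ≤ 2 := by
    intro s t hst h
    have h' : H t - H s ≤ a := (le_abs_self _).trans h
    refine sum_iterate_length_le_two hL.smooth H.monotone hL.conj hL.add_int Q hst ?_
      (Or.inr ⟨H.strictMono, fun j hj hjQ k => h'.trans (hR.separated j hj hjQ k)⟩)
    have h1 := hL.add_int s 1
    push_cast at h1
    exact H.le_iff_le.1 (by rw [h1]; linarith [hR.le_one])
  have hmono : ∀ j, Monotone G^[j] := fun j => hL.smooth.strictMono.monotone.iterate j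
  rcases le_total u v with h | h
  · refine le_of_eq_of_le (Finset.sum_congr rfl fun i _ => ?_)
      (aux u v h (by rwa [abs_sub_comm]))
    rw [abs_sub_comm, abs_of_nonneg (sub_nonneg.2 (hmono i h))]
  · refine le_of_eq_of_le (Finset.sum_congr rfl fun i _ => ?_) (aux v u h huv)
    rw [abs_of_nonneg (sub_nonneg.2 (hmono i h))]

lemma sum_abs_iterate_sub_le_four (hL : LinearizedLift G D N σ B H α) (hR : RotationScale α a Q)
    {u v : ℝ} (huv : |H u - H v| ≤ a) {l : ℕ} (hl : l ≤ 2 * Q) :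
    ∑ j ∈ Finset.range l, |G^[j] u - G^[j] v| ≤ 4 := by
  refine (Finset.sum_le_sum_of_subset_of_nonneg (Finset.range_subset_range.2 hl)
    fun _ _ _ => abs_nonneg _).trans ?_
  rw [two_mul, Finset.sum_range_add]
  have h1 := hL.sum_abs_iterate_sub_le hR huv
  have h2 := hL.sum_abs_iterate_sub_le hR (u := G^[Q] u) (v := G^[Q] v) (by
    rw [hL.apply_iterate, hL.apply_iterate]
    simpa using huv)
  simp only [← Function.iterate_add_apply] at h2
  simp only [add_comm Q]
  linarith

lemma abs_log_derivIter_sub_le_four (hL : LinearizedLift G D N σ B H α)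
    (hR : RotationScale α a Q) {u v : ℝ} (huv : |H u - H v| ≤ a) {l : ℕ} (hl : l ≤ 2 * Q) :
    |Real.log (derivIter G D l u) - Real.log (derivIter G D l v)| ≤ 4 * B := by
  refine (hL.smooth.abs_log_derivIter_sub_le l u v).trans ?_
  rw [mul_comm]
  exact mul_le_mul_of_nonneg_right (hL.sum_abs_iterate_sub_le_four hR huv hl)
    hL.smooth.bound_nonneg

lemma exists_midpoint {u v : ℝ} (huv : |H u - H v| ≤ 2 * a) :
    ∃ z, |H u - H z| ≤ a ∧ |H z - H v| ≤ a := by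
  refine ⟨H.symm ((H u + H v) / 2), ?_, ?_⟩ <;> rw [OrderIso.apply_symm_apply] <;>
    rw [abs_le] at huv ⊢ <;> constructor <;> linarith

/-- The first `Q` translates of a neighbourhood of any point cover the circle. -/
lemma exists_eq_iterate_add (hL : LinearizedLift G D N σ B H α) (hR : RotationScale α a Q)
    (u y : ℝ) : ∃ i < Q, ∃ (k : ℤ) (x : ℝ), y = G^[i] x + k ∧ |H x - H u| ≤ 2 * a := by
  obtain ⟨i, hi, k, h⟩ := hR.cover (H y - H u)
  refine ⟨i, hi, k, H.symm (H y - i * α - k), H.injective ?_, ?_⟩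
  · rw [hL.add_int, hL.apply_iterate, OrderIso.apply_symm_apply]
    ring
  · rw [OrderIso.apply_symm_apply]
    convert h using 2
    ring

/-- Since `G^Q` commutes with all iterates `G^i`, whose orbits of a small interval cover the
circle, a bound for the distortion of all `G^l` on small intervals bounds the derivative of `G^Q`
everywhere; the point where this derivative equals `1` serves as a base point. -/
lemma abs_log_derivIter_le (hL : LinearizedLift G D N σ B H α) (hR : RotationScale α a Q) {η : ℝ}
    (hη : ∀ u v : ℝ, |H u - H v| ≤ 2 * a → ∀ l ≤ Q,
      |Real.log (derivIter G D l u) - Real.log (derivIter G D l v)| ≤ η) (y : ℝ) :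
    |Real.log (derivIter G D Q y)| ≤ 2 * η := by
  have hG := hL.smooth
  obtain ⟨x₀, -, hx₀⟩ := hG.exists_derivIter_eq Q zero_le_one
  have hx₀' : derivIter G D Q x₀ = 1 := by
    have := hG.iterate_add_int Q 0 1
    push_cast at this
    rw [zero_add] at this
    rw [this] at hx₀
    linarith
  obtain ⟨i, hi, k, x, rfl, hx⟩ := hL.exists_eq_iterate_add hR x₀ y
  rw [hG.derivIter_add_int]
  obtain ⟨P, hP⟩ := hR.returns
  have hcomm : Real.log (derivIter G D Q (G^[i] x)) = Real.log (derivIter G D Q x) +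
      (Real.log (derivIter G D i (G^[Q] x)) - Real.log (derivIter G D i x)) := by
    have h := (derivIter_add G D i Q x).symm.trans
      ((congrArg (fun n => derivIter G D n x) (add_comm i Q)).trans (derivIter_add G D Q i x))
    have h' := congrArg Real.log h
    rw [Real.log_mul (hG.derivIter_pos _ _).ne' (hG.derivIter_pos _ _).ne',
      Real.log_mul (hG.derivIter_pos _ _).ne' (hG.derivIter_pos _ _).ne'] at h'
    linarith
  have h1 := hη x x₀ hx Q le_rfl
  rw [hx₀', Real.log_one, sub_zero] at h1
  have h2 := hη (G^[Q] x + (-P : ℤ)) x (by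
    rw [hL.add_int, hL.apply_iterate]
    push_cast
    have : H x + Q * α + -P - H x = Q * α - P := by ring
    rw [this]
    linarith [hR.pos]) i hi.le
  rw [hG.derivIter_add_int] at h2
  rw [hcomm]
  refine (abs_add_le _ _).trans ?_
  linarith

/-- Denjoy's inequality. -/
lemma abs_log_derivIter_le_denjoy (hL : LinearizedLift G D N σ B H α) (hR : RotationScale α a Q)
    (y : ℝ) : |Real.log (derivIter G D Q y)| ≤ 16 * B := by
  have := hL.abs_log_derivIter_le hR (η := 8 * B) (fun u v huv l hl => by
    obtain ⟨z, h1, h2⟩ := exists_midpoint huv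
    have h3 := hL.abs_log_derivIter_sub_le_four hR h1 (l := l) (by omega)
    have h4 := hL.abs_log_derivIter_sub_le_four hR h2 (l := l) (by omega)
    have := abs_sub_le (Real.log (derivIter G D l u)) (Real.log (derivIter G D l z))
      (Real.log (derivIter G D l v))
    linarith) y
  linarith

/-- The displacements at `x` and at `G^j x` differ by the derivative of `G^j` at a nearby point. -/
lemma exists_gap_iterate_eq (hL : LinearizedLift G D N σ B H α) (hθ : |θ| = a) (j : ℕ) (x : ℝ) :
    ∃ ξ, |H ξ - H x| ≤ a ∧ gap H θ (G^[j] x) = derivIter G D j ξ * gap H θ x := by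
  have hG := hL.smooth
  have hs := apply_shift H θ x
  rw [hL.gap_iterate, gap]
  rcases le_total x (shift H θ x) with h | h
  · obtain ⟨ξ, hξ, h'⟩ := hG.exists_derivIter_eq j h
    have h1 := H.monotone hξ.1
    have h2 := H.monotone hξ.2
    have h3 := le_abs_self θ
    refine ⟨ξ, abs_le.2 ⟨by linarith [abs_nonneg θ], by linarith⟩, ?_⟩
    rw [h', abs_mul, abs_of_pos (hG.derivIter_pos j ξ)]
  · obtain ⟨ξ, hξ, h'⟩ := hG.exists_derivIter_eq j h
    have h1 := H.monotone hξ.1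
    have h2 := H.monotone hξ.2
    have h3 := neg_abs_le θ
    refine ⟨ξ, abs_le.2 ⟨by linarith, by linarith [abs_nonneg θ]⟩, ?_⟩
    rw [abs_sub_comm, h', abs_mul, abs_of_pos (hG.derivIter_pos j ξ), abs_sub_comm]

lemma gap_iterate_le (hL : LinearizedLift G D N σ B H α) (hR : RotationScale α a Q)
    (hθ : |θ| = a) {j : ℕ} (hj : j ≤ 2 * Q) (x : ℝ) :
    gap H θ (G^[j] x) ≤ Real.exp (4 * B) * derivIter G D j x * gap H θ x := by
  obtain ⟨ξ, hξ, h⟩ := hL.exists_gap_iterate_eq hθ j x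
  rw [h]
  exact mul_le_mul_of_nonneg_right (le_exp_mul_of_abs_log_sub_le (hL.smooth.derivIter_pos _ _)
    (hL.smooth.derivIter_pos _ _) (hL.abs_log_derivIter_sub_le_four hR hξ hj)) (abs_nonneg _)

lemma derivIter_mul_gap_le (hL : LinearizedLift G D N σ B H α) (hR : RotationScale α a Q)
    (hθ : |θ| = a) {j : ℕ} (hj : j ≤ 2 * Q) (x : ℝ) :
    derivIter G D j x * gap H θ x ≤ Real.exp (4 * B) * gap H θ (G^[j] x) := by
  obtain ⟨ξ, hξ, h⟩ := hL.exists_gap_iterate_eq hθ j x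
  rw [h, ← mul_assoc]
  rw [abs_sub_comm] at hξ
  exact mul_le_mul_of_nonneg_right (le_exp_mul_of_abs_log_sub_le (hL.smooth.derivIter_pos _ _)
    (hL.smooth.derivIter_pos _ _) (hL.abs_log_derivIter_sub_le_four hR hξ hj)) (abs_nonneg _)

lemma sum_derivIter_sq_le (hL : LinearizedLift G D N σ B H α) (hR : RotationScale α a Q)
    (hθ : |θ| = a) {M : ℝ} (hM : ∀ x, gap H θ x ≤ M) {l : ℕ} (hl : l ≤ 2 * Q) (x : ℝ) :
    (∑ j ∈ Finset.range l, derivIter G D j x ^ 2) * gap H θ x ^ 2 ≤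
      4 * Real.exp (4 * B) ^ 2 * M := by
  rw [Finset.sum_mul]
  have hM0 : 0 ≤ M := (abs_nonneg _).trans (hM 0)
  have h1 : ∀ j ∈ Finset.range l, derivIter G D j x ^ 2 * gap H θ x ^ 2 ≤
      Real.exp (4 * B) ^ 2 * M * |G^[j] (shift H θ x) - G^[j] x| := by
    intro j hj
    have hj' : j ≤ 2 * Q := (Finset.mem_range.1 hj).le.trans hl
    have h2 := hL.derivIter_mul_gap_le hR hθ hj' x
    have h3 := hL.smooth.derivIter_pos j x
    have h4 : 0 ≤ gap H θ x := abs_nonneg _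
    have h5 : 0 ≤ gap H θ (G^[j] x) := abs_nonneg _
    rw [← hL.gap_iterate, ← mul_pow]
    calc _ ≤ (Real.exp (4 * B) * gap H θ (G^[j] x)) ^ 2 := by gcongr
      _ = Real.exp (4 * B) ^ 2 * gap H θ (G^[j] x) * gap H θ (G^[j] x) := by ring
      _ ≤ _ := by gcongr; exact hM _
  refine (Finset.sum_le_sum h1).trans ?_
  rw [← Finset.mul_sum]
  have h2 := hL.sum_abs_iterate_sub_le_four hR (u := shift H θ x) (v := x)
    (by rw [apply_shift, add_sub_cancel_left]; exact hθ.le) hl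
  have h3 : 0 ≤ Real.exp (4 * B) ^ 2 * M := by positivity
  nlinarith

section Comparison

variable {c : ℝ}

lemma abs_sub_le_gap (hθ : |θ| = a) (hc : 1 ≤ c)
    (hcθ : ∀ x, gap H θ x ≤ c * gap H θ (shift H θ x)) {x y : ℝ} (hxy : |H y - H x| ≤ a) :
    |y - x| ≤ c * gap H θ x := by
  have h1 : |shift H θ x - x| ≤ c * gap H θ x := by
    have : 0 ≤ gap H θ x := abs_nonneg _
    change gap H θ x ≤ _
    nlinarith
  have h2 : |shift H (-θ) x - x| ≤ c * gap H θ x := by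
    have := hcθ (shift H (-θ) x)
    have hs : shift H θ (shift H (-θ) x) = x := H.injective (by simp)
    rwa [hs, gap, hs, abs_sub_comm] at this
  have hs1 := apply_shift H θ x
  have hs2 := apply_shift H (-θ) x
  rw [abs_le] at hxy h1 h2 ⊢
  rcases abs_cases θ with ⟨h, -⟩ | ⟨h, -⟩
  · have e1 : y ≤ shift H θ x := H.le_iff_le.1 (by rw [hs1]; linarith)
    have e2 : shift H (-θ) x ≤ y := H.le_iff_le.1 (by rw [hs2]; linarith)
    constructor <;> linarith
  · have e1 : y ≤ shift H (-θ) x := H.le_iff_le.1 (by rw [hs2]; linarith)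
    have e2 : shift H θ x ≤ y := H.le_iff_le.1 (by rw [hs1]; linarith)
    constructor <;> linarith

lemma gap_le_gap (hθ : |θ| = a) (hc : 1 ≤ c)
    (hcθ : ∀ x, gap H θ x ≤ c * gap H θ (shift H θ x))
    (hcθ' : ∀ x, gap H θ (shift H θ x) ≤ c * gap H θ x) {x y : ℝ} (hxy : |H y - H x| ≤ a) :
    gap H θ y ≤ 3 * c ^ 2 * gap H θ x := by
  have h1 := abs_sub_le_gap hθ hc hcθ hxy
  have h2 := abs_sub_le_gap hθ hc hcθ (x := shift H θ x) (y := shift H θ y) (by simpa using hxy)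
  have h3 := hcθ' x
  have h0 : 0 ≤ gap H θ x := abs_nonneg _
  have h4 : gap H θ y ≤ |shift H θ y - shift H θ x| + gap H θ x + |y - x| := by
    have e : shift H θ y - y = (shift H θ y - shift H θ x) + (shift H θ x - x) + (x - y) := by ring
    rw [gap, e, abs_sub_comm y x]
    exact abs_add_three _ _ _
  have h5 : c * gap H θ (shift H θ x) ≤ c ^ 2 * gap H θ x := by
    rw [pow_two, mul_assoc]
    exact mul_le_mul_of_nonneg_left h3 (by linarith)
  have h6 : gap H θ x ≤ c ^ 2 * gap H θ x := le_mul_of_one_le_left h0 (one_le_pow₀ hc)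
  have h7 : c * gap H θ x ≤ c ^ 2 * gap H θ x :=
    mul_le_mul_of_nonneg_right (le_self_pow₀ hc two_ne_zero) h0
  linarith

lemma gap_le_gap_two (hθ : |θ| = a) (hc : 1 ≤ c)
    (hcθ : ∀ x, gap H θ x ≤ c * gap H θ (shift H θ x))
    (hcθ' : ∀ x, gap H θ (shift H θ x) ≤ c * gap H θ x) {x y : ℝ} (hxy : |H y - H x| ≤ 2 * a) :
    gap H θ y ≤ 9 * c ^ 4 * gap H θ x := by
  obtain ⟨z, h1, h2⟩ := exists_midpoint hxy
  have h3 := gap_le_gap hθ hc hcθ hcθ' h1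
  have h4 := gap_le_gap hθ hc hcθ hcθ' h2
  calc _ ≤ 3 * c ^ 2 * gap H θ z := h3
    _ ≤ 3 * c ^ 2 * (3 * c ^ 2 * gap H θ x) := by gcongr
    _ = _ := by ring

lemma abs_sub_le_gap_two (hθ : |θ| = a) (hc : 1 ≤ c)
    (hcθ : ∀ x, gap H θ x ≤ c * gap H θ (shift H θ x))
    (hcθ' : ∀ x, gap H θ (shift H θ x) ≤ c * gap H θ x) {x y : ℝ} (hxy : |H y - H x| ≤ 2 * a) :
    |y - x| ≤ 4 * c ^ 3 * gap H θ x := by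
  obtain ⟨z, h1, h2⟩ := exists_midpoint hxy
  have h3 := abs_sub_le_gap hθ hc hcθ h1
  have h4 := abs_sub_le_gap hθ hc hcθ h2
  have h5 := gap_le_gap hθ hc hcθ hcθ' h2
  have h6 := abs_sub_le y z x
  have h0 : 0 ≤ gap H θ x := abs_nonneg _
  have h7 : c * gap H θ z ≤ c * (3 * c ^ 2 * gap H θ x) :=
    mul_le_mul_of_nonneg_left h5 (by linarith)
  have h8 : c * gap H θ x ≤ c ^ 3 * gap H θ x :=
    mul_le_mul_of_nonneg_right (le_self_pow₀ hc three_ne_zero) h0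
  nlinarith

/-- Maximum principle: where the nonlinearity of `G^l` is largest in absolute value, its derivative
vanishes and it is controlled by the Schwarzian derivative alone. -/
lemma nonlinIter_sq_le (hL : LinearizedLift G D N σ B H α) {l : ℕ} {K : ℝ}
    (hK : ∀ x, ∑ j ∈ Finset.range l, derivIter G D j x ^ 2 ≤ K) (y : ℝ) :
    nonlinIter G D N l y ^ 2 ≤ 2 * B * K := by
  have hG := hL.smooth
  have hcont : Continuous fun x => -(nonlinIter G D N l x ^ 2) :=
    ((continuous_iff_continuousAt.2
      fun x => (hG.hasDerivAt_nonlinIter l x).continuousAt).pow 2).neg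
  obtain ⟨x₀, hx₀⟩ := exists_forall_le_of_periodic hcont
    (fun x k => by rw [hG.nonlinIter_add_int])
  have hmin : IsLocalMin (fun x => -(nonlinIter G D N l x ^ 2)) x₀ :=
    Filter.Eventually.of_forall hx₀
  have h0 := hmin.hasDerivAt_eq_zero ((hG.hasDerivAt_nonlinIter l x₀).pow 2).neg
  set w := nonlinIter G D N l x₀
  set S := ∑ i ∈ Finset.range l, σ (G^[i] x₀) * derivIter G D i x₀ ^ 2
  have hS : |S| ≤ B * K := by
    refine (Finset.abs_sum_le_sum_abs _ _).trans ?_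
    have : ∀ i ∈ Finset.range l, |σ (G^[i] x₀) * derivIter G D i x₀ ^ 2| ≤
        B * derivIter G D i x₀ ^ 2 := fun i _ => by
      rw [abs_mul, abs_of_nonneg (sq_nonneg (derivIter G D i x₀))]
      exact mul_le_mul_of_nonneg_right (hG.schwarz_le _) (sq_nonneg _)
    refine (Finset.sum_le_sum this).trans ?_
    rw [← Finset.mul_sum]
    exact mul_le_mul_of_nonneg_left (hK x₀) hG.bound_nonneg
  have hw : w ^ 2 ≤ 2 * B * K := by
    have h1 : w * (w ^ 2 / 2 + S) = 0 := by
      have : (2 : ℝ) * (w * (w ^ 2 / 2 + S)) = 0 := by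
        simpa [mul_assoc] using h0
      linarith
    rcases mul_eq_zero.1 h1 with h | h
    · rw [h]
      have := (abs_nonneg S).trans hS
      nlinarith
    · have := neg_abs_le S
      linarith
  linarith [hx₀ y]

/-- The nonlinearity of `G^l`, measured at the scale of the local displacement, is small. The
maximum principle gives this near the point of smallest displacement, and the cocycle relation for
the nonlinearity spreads it along the orbits of a neighbourhood of that point. -/
lemma abs_nonlinIter_mul_gap_le (hL : LinearizedLift G D N σ B H α) (hR : RotationScale α a Q)
    (hθ : |θ| = a) (hc : 1 ≤ c) (hcθ : ∀ x, gap H θ x ≤ c * gap H θ (shift H θ x))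
    (hcθ' : ∀ x, gap H θ (shift H θ x) ≤ c * gap H θ x) {M : ℝ} (hM : ∀ x, gap H θ x ≤ M)
    {l : ℕ} (hl : l ≤ Q) (y : ℝ) :
    |nonlinIter G D N l y| * gap H θ y ≤
      18 * c ^ 4 * Real.exp (4 * B) ^ 2 * √(8 * B * M) := by
  have hG := hL.smooth
  have hB := hG.bound_nonneg
  have hM0 : 0 ≤ M := (abs_nonneg _).trans (hM 0)
  have hθ0 : θ ≠ 0 := by
    rintro rfl
    rw [abs_zero] at hθ
    exact hR.pos.ne hθ
  obtain ⟨x₀, hx₀⟩ := exists_forall_le_of_periodic (continuous_gap H θ)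
    (fun x k => hL.gap_add_int x k)
  set μ := gap H θ x₀
  have hμ : 0 < μ := gap_pos H hθ0 x₀
  set e := Real.exp (4 * B)
  have he : 0 < e := Real.exp_pos _
  set S := e * √(8 * B * M)
  have hglob : ∀ j ≤ 2 * Q, ∀ x, |nonlinIter G D N j x| * μ ≤ S := by
    intro j hj x
    have h1 : ∀ x, ∑ i ∈ Finset.range j, derivIter G D i x ^ 2 ≤ 4 * e ^ 2 * M / μ ^ 2 := by
      intro x
      rw [le_div_iff₀ (by positivity)]
      refine le_trans ?_ (hL.sum_derivIter_sq_le hR hθ hM hj x)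
      have h0 : 0 ≤ ∑ i ∈ Finset.range j, derivIter G D i x ^ 2 :=
        Finset.sum_nonneg fun _ _ => sq_nonneg _
      gcongr
      exact hx₀ x
    have h2 := hL.nonlinIter_sq_le h1 x
    have h3 : (|nonlinIter G D N j x| * μ) ^ 2 ≤ S ^ 2 := by
      rw [mul_pow, sq_abs, mul_pow, Real.sq_sqrt (by positivity)]
      calc _ ≤ 2 * B * (4 * e ^ 2 * M / μ ^ 2) * μ ^ 2 := by gcongr
        _ = _ := by field_simp; ring
    exact (pow_le_pow_iff_left₀ (by positivity) (by positivity) two_ne_zero).1 h3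
  obtain ⟨i, hi, k, x, rfl, hx⟩ := hL.exists_eq_iterate_add hR x₀ y
  rw [hG.nonlinIter_add_int, hL.gap_add_int]
  have h1 := hglob (i + l) (by omega) x
  have h2 := hglob i (by omega) x
  have hd := hG.derivIter_pos i x
  have h3 : derivIter G D i x * |nonlinIter G D N l (G^[i] x)| * μ ≤ 2 * S := by
    have : derivIter G D i x * nonlinIter G D N l (G^[i] x) =
        nonlinIter G D N (i + l) x - nonlinIter G D N i x := by
      rw [nonlinIter_add]; ring
    rw [← abs_of_pos hd, ← abs_mul, this]
    have := mul_le_mul_of_nonneg_right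
      (abs_sub (nonlinIter G D N (i + l) x) (nonlinIter G D N i x)) hμ.le
    linarith
  have h4 := hL.gap_iterate_le hR hθ (j := i) (by omega) x
  have h5 := gap_le_gap_two hθ hc hcθ hcθ' hx
  set w := |nonlinIter G D N l (G^[i] x)|
  have hw : 0 ≤ w := abs_nonneg _
  calc w * gap H θ (G^[i] x) ≤ w * (e * derivIter G D i x * (9 * c ^ 4 * μ)) := by
        refine mul_le_mul_of_nonneg_left (h4.trans ?_) hw
        gcongr
    _ = 9 * c ^ 4 * e * (derivIter G D i x * w * μ) := by ring
    _ ≤ 9 * c ^ 4 * e * (2 * S) := by gcongr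
    _ = _ := by simp only [S]; ring

lemma abs_log_derivIter_sub_le_of_nonlin (hL : LinearizedLift G D N σ B H α)
    (hθ : |θ| = a) (hθ0 : θ ≠ 0) (hc : 1 ≤ c) (hcθ : ∀ x, gap H θ x ≤ c * gap H θ (shift H θ x))
    (hcθ' : ∀ x, gap H θ (shift H θ x) ≤ c * gap H θ x) {l : ℕ} {κ : ℝ}
    (hκ : ∀ y, |nonlinIter G D N l y| * gap H θ y ≤ κ) {u v : ℝ} (huv : |H u - H v| ≤ 2 * a) :
    |Real.log (derivIter G D l u) - Real.log (derivIter G D l v)| ≤ 36 * c ^ 7 * κ := by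
  have hG := hL.smooth
  have hder : ∀ x, HasDerivAt (fun x => Real.log (derivIter G D l x)) (nonlinIter G D N l x) x :=
    fun x => by
      convert (hG.hasDerivAt_derivIter l x).log (hG.derivIter_pos l x).ne' using 1
      rw [mul_div_cancel_left₀ _ (hG.derivIter_pos l x).ne']
  have hv := gap_pos H hθ0 v
  have hκ0 : 0 ≤ κ := (mul_nonneg (abs_nonneg _) (abs_nonneg _)).trans (hκ 0)
  have hbound : ∀ x ∈ Set.uIcc v u, ‖nonlinIter G D N l x‖ ≤ 9 * c ^ 4 * κ / gap H θ v := by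
    intro x hx
    have hxv : |H x - H v| ≤ 2 * a := by
      refine le_trans ?_ huv
      rcases Set.mem_uIcc.1 hx with ⟨h1, h2⟩ | ⟨h1, h2⟩
      · rw [abs_of_nonneg (sub_nonneg.2 (H.monotone h1)),
          abs_of_nonneg (sub_nonneg.2 (H.monotone (h1.trans h2)))]
        linarith [H.monotone h2]
      · rw [abs_of_nonpos (sub_nonpos.2 (H.monotone h2)),
          abs_of_nonpos (sub_nonpos.2 (H.monotone (h1.trans h2)))]
        linarith [H.monotone h1]
    have h1 := gap_le_gap_two hθ hc hcθ hcθ' (x := x) (y := v) (by rwa [abs_sub_comm])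
    rw [Real.norm_eq_abs, le_div_iff₀ hv]
    calc _ ≤ |nonlinIter G D N l x| * (9 * c ^ 4 * gap H θ x) := by gcongr
      _ = 9 * c ^ 4 * (|nonlinIter G D N l x| * gap H θ x) := by ring
      _ ≤ _ := by gcongr; exact hκ x
  have h1 := (convex_uIcc v u).norm_image_sub_le_of_norm_hasDerivWithin_le
    (fun x _ => (hder x).hasDerivWithinAt) hbound Set.left_mem_uIcc Set.right_mem_uIcc
  have h2 := abs_sub_le_gap_two hθ hc hcθ hcθ' huv
  rw [Real.norm_eq_abs, Real.norm_eq_abs] at h1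
  calc _ ≤ 9 * c ^ 4 * κ / gap H θ v * |u - v| := h1
    _ ≤ 9 * c ^ 4 * κ / gap H θ v * (4 * c ^ 3 * gap H θ v) := by gcongr
    _ = _ := by field_simp; ring

end Comparison

end LinearizedLift

/-- The estimates for the first `Q` iterates at a scale where the displacement is `gap H θ`, with
error `δ` and bounded constant `C`. -/
structure ScaleEstimates (G D N : ℝ → ℝ) (H : ℝ ≃o ℝ) (θ : ℝ) (Q : ℕ) (C δ : ℝ) : Prop where
  abs_nonlin_le : ∀ l ≤ Q, ∀ y, |nonlinIter G D N l y| * gap H θ y ≤ δ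
  sum_sq_le : ∀ l ≤ Q, ∀ x, (∑ j ∈ Finset.range l, derivIter G D j x ^ 2) * gap H θ x ^ 2 ≤ δ
  derivIter_mul_gap_le : ∀ l ≤ Q, ∀ x, derivIter G D l x * gap H θ x ≤ δ
  gap_iterate : ∀ l ≤ Q, ∀ x,
    |Real.log (gap H θ (G^[l] x)) - Real.log (derivIter G D l x * gap H θ x)| ≤ δ
  gap_return : ∀ x, |Real.log (gap H θ (G^[Q] x)) - Real.log (gap H θ x)| ≤ δ
  return_le : ∀ x y, |H y - H x| ≤ |θ| → |y - x| ≤ C * gap H θ x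

/-- The estimates hold at all scales with an error of the order of the square root of the largest
displacement. The shift by `θ` is given by an earlier closest return of `G`. -/
theorem exists_scaleEstimates {G D N σ : ℝ → ℝ} {B α : ℝ} {H : ℝ ≃o ℝ}
    (hL : LinearizedLift G D N σ B H α) :
    ∃ C₁ : ℝ, 0 < C₁ ∧ ∃ C₂ : ℝ, 0 < C₂ ∧
      ∀ (a a' θ M : ℝ) (Q Q' : ℕ) (P : ℤ), RotationScale α a Q → RotationScale α a' Q' →
        θ = Q' * α - P → |θ| = a → (∀ x, gap H θ x ≤ M) →
        ScaleEstimates G D N H θ Q C₁ (C₂ * (√M + M)) := by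
  have hG := hL.smooth
  have hB := hG.bound_nonneg
  set c := Real.exp (16 * B)
  have hc : 1 ≤ c := Real.one_le_exp (by positivity)
  set e := Real.exp (4 * B)
  have he : 1 ≤ e := Real.one_le_exp (by positivity)
  set K := 18 * c ^ 4 * e ^ 2 * √(8 * B)
  have hK0 : 0 ≤ K := by positivity
  refine ⟨c, by positivity, (1 + 108 * c ^ 7) * K + 4 * e ^ 2, by positivity, ?_⟩
  intro a a' θ M Q Q' P hR hR' hθP hθ hM
  have hθ0 : θ ≠ 0 := by
    rintro rfl
    rw [abs_zero] at hθ
    exact hR.pos.ne hθ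
  have hM0 : 0 ≤ M := (abs_nonneg _).trans (hM 0)
  have hshift : ∀ x, shift H θ x = G^[Q'] x + (-P : ℤ) := fun x => by
    apply H.injective
    rw [apply_shift, hL.add_int, hL.apply_iterate, hθP]
    push_cast
    ring
  have hgs : ∀ x, ∃ ξ, gap H θ (shift H θ x) = derivIter G D Q' ξ * gap H θ x := fun x => by
    obtain ⟨ξ, -, h⟩ := hL.exists_gap_iterate_eq hθ Q' x
    refine ⟨ξ, ?_⟩
    rw [← h]
    conv_lhs => rw [hshift x, hL.gap_add_int]
  have hdj := hL.abs_log_derivIter_le_denjoy hR'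
  have hcθ' : ∀ x, gap H θ (shift H θ x) ≤ c * gap H θ x := fun x => by
    obtain ⟨ξ, h⟩ := hgs x
    rw [h]
    refine mul_le_mul_of_nonneg_right ?_ (abs_nonneg _)
    rw [← Real.exp_log (hG.derivIter_pos Q' ξ)]
    exact Real.exp_le_exp.2 (abs_le.1 (hdj ξ)).2
  have hcθ : ∀ x, gap H θ x ≤ c * gap H θ (shift H θ x) := fun x => by
    obtain ⟨ξ, h⟩ := hgs x
    rw [h, ← mul_assoc]
    refine le_mul_of_one_le_left (abs_nonneg _) ?_
    rw [← Real.exp_log (hG.derivIter_pos Q' ξ), ← Real.exp_add]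
    exact Real.one_le_exp (by linarith [(abs_le.1 (hdj ξ)).1])
  have hsqrt : 18 * c ^ 4 * e ^ 2 * √(8 * B * M) = K * √M := by
    rw [Real.sqrt_mul (by positivity)]
    ring
  have hw : ∀ l ≤ Q, ∀ y, |nonlinIter G D N l y| * gap H θ y ≤ K * √M := fun l hl y => by
    rw [← hsqrt]
    exact hL.abs_nonlinIter_mul_gap_le hR hθ hc hcθ hcθ' hM hl y
  have hdist : ∀ u v : ℝ, |H u - H v| ≤ 2 * a → ∀ l ≤ Q,
      |Real.log (derivIter G D l u) - Real.log (derivIter G D l v)| ≤ 36 * c ^ 7 * (K * √M) :=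
    fun u v huv l hl =>
      hL.abs_log_derivIter_sub_le_of_nonlin hθ hθ0 hc hcθ hcθ' (hw l hl) huv
  have hret := hL.abs_log_derivIter_le hR hdist
  have hKM : 0 ≤ K * √M := by positivity
  have hcKM : 0 ≤ c ^ 7 * (K * √M) := by positivity
  have heM : 0 ≤ e ^ 2 * M := by positivity
  have hrest : 0 ≤ ((1 + 108 * c ^ 7) * K) * M + 4 * e ^ 2 * √M := by positivity
  have hexp : ((1 + 108 * c ^ 7) * K + 4 * e ^ 2) * (√M + M) =
      K * √M + 108 * (c ^ 7 * (K * √M)) + 4 * (e ^ 2 * M) +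
        (((1 + 108 * c ^ 7) * K) * M + 4 * e ^ 2 * √M) := by ring
  have hgi : ∀ l ≤ Q, ∀ x, |Real.log (gap H θ (G^[l] x)) -
      Real.log (derivIter G D l x * gap H θ x)| ≤ 36 * (c ^ 7 * (K * √M)) := by
    intro l hl x
    obtain ⟨ξ, hξ, h⟩ := hL.exists_gap_iterate_eq hθ l x
    have hg := (gap_pos H hθ0 x).ne'
    rw [h, Real.log_mul (hG.derivIter_pos _ _).ne' hg,
      Real.log_mul (hG.derivIter_pos _ _).ne' hg, add_sub_add_right_eq_sub, ← mul_assoc]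
    exact hdist ξ x (by linarith [hR.pos]) l hl
  refine ⟨fun l hl y => (hw l hl y).trans ?_, fun l hl x => ?_, fun l hl x => ?_, fun l hl x => ?_,
    fun x => ?_, fun x y hxy => ?_⟩
  · rw [hexp]; linarith
  · refine (hL.sum_derivIter_sq_le hR hθ hM (by omega) x).trans ?_
    rw [hexp]; change 4 * e ^ 2 * M ≤ _; linarith
  · refine (hL.derivIter_mul_gap_le hR hθ (j := l) (by omega) x).trans ?_
    have h1 : e * gap H θ (G^[l] x) ≤ e ^ 2 * M := by
      have : e ≤ e ^ 2 := le_self_pow₀ he two_ne_zero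
      have h0 : 0 ≤ gap H θ (G^[l] x) := abs_nonneg _
      exact mul_le_mul this (hM _) h0 (by positivity)
    rw [hexp]; change e * gap H θ (G^[l] x) ≤ _; linarith
  · refine (hgi l hl x).trans ?_
    rw [hexp]; linarith
  · have h1 := hgi Q le_rfl x
    have h2 := hret x
    rw [Real.log_mul (hG.derivIter_pos _ _).ne' (gap_pos H hθ0 x).ne'] at h1
    have h3 : Real.log (gap H θ (G^[Q] x)) - Real.log (gap H θ x) =
        (Real.log (gap H θ (G^[Q] x)) - (Real.log (derivIter G D Q x) + Real.log (gap H θ x))) +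
          Real.log (derivIter G D Q x) := by ring
    rw [h3, hexp]
    refine (abs_add_le _ _).trans ?_
    linarith
  · rw [hθ] at hxy
    exact LinearizedLift.abs_sub_le_gap hθ hc hcθ hxy

/-! ### The complex extension near the circle -/

lemma exists_bound_of_periodic {f : ℝ → ℝ} (hf : Continuous f) (hp : ∀ x, f (x + 1) = f x) :
    ∃ b, ∀ x, f x ≤ b := by
  obtain ⟨x₀, h⟩ := exists_forall_le_of_periodic hf.neg fun x k => by
    simpa using (Function.Periodic.int_mul (f := f) (c := 1) hp k) x
  exact ⟨f x₀, fun x => by simpa using h x⟩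

lemma exists_smoothLift {G : CircleDeg1Lift} (hG : IsAnalyticCircleDiffeo G) :
    ∃ (D N σ : ℝ → ℝ) (B : ℝ), SmoothLift G D N σ B := by
  have hper : ∀ {f : ℝ → ℝ}, (∀ x, f (x + 1) = f x) → ∀ x, deriv f (x + 1) = deriv f x := by
    intro f hf x
    rw [← deriv_comp_add_const]
    congr 1
    exact funext hf
  have hA : ∀ x, AnalyticAt ℝ G x := fun x => hG.analytic x (Set.mem_univ x)
  set D := deriv G with hD
  have hDA : ∀ x, AnalyticAt ℝ D x := fun x => (hA x).deriv
  have hpos : ∀ x, 0 < D x := hG.deriv_pos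
  have hDp : ∀ x, D (x + 1) = D x := fun x => by
    rw [hD, ← deriv_comp_add_const]
    have : (fun y => G (y + 1)) = fun y => G y + 1 := funext G.map_add_one
    rw [this, deriv_add_const]
  set N : ℝ → ℝ := fun x => deriv D x / D x with hN
  have hNA : ∀ x, AnalyticAt ℝ N x := fun x => (hDA x).deriv.div (hDA x) (hpos x).ne'
  have hNp : ∀ x, N (x + 1) = N x := fun x => by simp only [hN, hDp, hper hDp]
  set σ : ℝ → ℝ := fun x => deriv N x - N x ^ 2 / 2 with hσ
  have hσp : ∀ x, σ (x + 1) = σ x := fun x => by simp only [hσ, hNp, hper hNp]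
  have hNc : Continuous N := continuous_iff_continuousAt.2 fun x => (hNA x).continuousAt
  have hσc : Continuous σ :=
    (continuous_iff_continuousAt.2 fun x => (hNA x).deriv.continuousAt).sub
      ((hNc.pow 2).div_const 2)
  obtain ⟨b₁, hb₁⟩ := exists_bound_of_periodic hNc.abs fun x => by rw [hNp]
  obtain ⟨b₂, hb₂⟩ := exists_bound_of_periodic hσc.abs fun x => by rw [hσp]
  refine ⟨D, N, σ, max b₁ b₂, fun x => (hA x).differentiableAt.hasDerivAt, hpos, fun x => ?_,
    fun x => ?_, fun x => (hb₁ x).trans (le_max_left _ _),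
    fun x => (hb₂ x).trans (le_max_right _ _),
    G.map_add_one, hDp, hNp⟩
  · rw [mul_div_cancel₀ _ (hpos x).ne']
    exact (hDA x).differentiableAt.hasDerivAt
  · rw [sub_add_cancel]
    exact (hNA x).differentiableAt.hasDerivAt

lemma E_add (z w : ℂ) : E (z + w) = E z * E w := by
  rw [E, E, E, ← Complex.exp_add, mul_add]

lemma E_zero : E 0 = 1 := by simp [E]

lemma E_ne_zero (z : ℂ) : E z ≠ 0 := Complex.exp_ne_zero _

lemma E_sub (z w : ℂ) : E (z - w) = E z / E w := by
  rw [eq_div_iff (E_ne_zero w), ← E_add, sub_add_cancel]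

lemma E_intCast (k : ℤ) : E k = 1 := by
  rw [E, mul_comm]
  exact Complex.exp_int_mul_two_pi_mul_I k

lemma E_add_int (z : ℂ) (k : ℤ) : E (z + k) = E z := by rw [E_add, E_intCast, mul_one]

lemma norm_E (z : ℂ) : ‖E z‖ = Real.exp (-(2 * Real.pi * z.im)) := by
  rw [E, Complex.norm_exp]
  congr 1
  simp

lemma norm_E_ofReal (x : ℝ) : ‖E x‖ = 1 := by simp [norm_E]

lemma differentiable_E : Differentiable ℂ E :=
  Complex.differentiable_exp.comp (differentiable_id.const_mul _)

/-- A holomorphic function bounded by `1` on a disk agrees with its second Taylor polynomial at the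
centre up to a cubic error depending only on the radius: divide three times by the variable. -/
lemma norm_sub_taylor_le {f : ℂ → ℂ} {R : ℝ} (hR : 0 < R)
    (hf : DifferentiableOn ℂ f (Metric.ball 0 R)) (h0 : f 0 = 0)
    (hb : ∀ ζ ∈ Metric.ball (0 : ℂ) R, ‖f ζ‖ ≤ 1) {ζ : ℂ} (hζ : ζ ∈ Metric.ball (0 : ℂ) R) :
    ‖f ζ - (deriv f 0 * ζ + deriv (deriv f) 0 / 2 * ζ ^ 2)‖ ≤ 4 / R ^ 3 * ‖ζ‖ ^ 3 := by
  have hnhds : Metric.ball (0 : ℂ) R ∈ nhds (0 : ℂ) := Metric.ball_mem_nhds 0 hR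
  have hmem : (0 : ℂ) ∈ Metric.ball (0 : ℂ) R := Metric.mem_ball_self hR
  have step : ∀ (F : ℂ → ℂ) (b : ℝ), DifferentiableOn ℂ F (Metric.ball 0 R) →
      (∀ ζ ∈ Metric.ball (0 : ℂ) R, ‖F ζ‖ ≤ b) →
      DifferentiableOn ℂ (dslope F 0) (Metric.ball 0 R) ∧
        ∀ ζ ∈ Metric.ball (0 : ℂ) R, ‖dslope F 0 ζ‖ ≤ 2 * b / R := by
    intro F b hF hFb
    refine ⟨(Complex.differentiableOn_dslope hnhds).2 hF, fun ζ hζ => ?_⟩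
    refine Complex.norm_dslope_le_div_of_mapsTo_ball hF (fun w hw => ?_) hζ
    rw [mem_closedBall_iff_norm]
    refine (norm_sub_le _ _).trans ?_
    linarith [hFb w hw, hFb 0 hmem]
  set φ₁ := dslope f 0
  set φ₂ := dslope φ₁ 0
  set φ₃ := dslope φ₂ 0
  have hb1 : DifferentiableOn ℂ φ₁ (Metric.ball 0 R) ∧
      ∀ ζ ∈ Metric.ball (0 : ℂ) R, ‖φ₁ ζ‖ ≤ 1 / R := by
    refine ⟨(Complex.differentiableOn_dslope hnhds).2 hf, fun ζ hζ => ?_⟩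
    refine Complex.norm_dslope_le_div_of_mapsTo_ball hf (fun w hw => ?_) hζ
    rw [mem_closedBall_iff_norm, h0, sub_zero]
    exact hb w hw
  have hb2 := step φ₁ _ hb1.1 hb1.2
  have hb3 := step φ₂ _ hb2.1 hb2.2
  have e1 : ∀ (F : ℂ → ℂ) (w : ℂ), F w = F 0 + w * dslope F 0 w := fun F w => by
    have := sub_smul_dslope F 0 w
    rw [sub_zero, smul_eq_mul] at this
    rw [this]
    ring
  have hderiv2 : deriv (deriv f) 0 = 2 * φ₂ 0 := by
    have hA : AnalyticAt ℂ φ₁ 0 := hb1.1.analyticAt hnhds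
    have hev : deriv f =ᶠ[nhds 0] fun w => φ₁ w + w * deriv φ₁ w := by
      filter_upwards [hA.eventually_analyticAt] with w hw
      have h1 : f = fun w => w * φ₁ w := funext fun w => by
        have := e1 f w
        rwa [h0, zero_add] at this
      have h2 : HasDerivAt (fun w => w * φ₁ w) (1 * φ₁ w + w * deriv φ₁ w) w :=
        (hasDerivAt_id w).mul hw.differentiableAt.hasDerivAt
      rw [one_mul, ← h1] at h2
      exact h2.deriv
    rw [hev.deriv_eq]
    have h3 : HasDerivAt (fun w => φ₁ w + w * deriv φ₁ w)
        (deriv φ₁ 0 + (1 * deriv φ₁ 0 + 0 * deriv (deriv φ₁) 0)) 0 :=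
      hA.differentiableAt.hasDerivAt.add
        ((hasDerivAt_id (0 : ℂ)).mul hA.deriv.differentiableAt.hasDerivAt)
    rw [h3.deriv]
    have : φ₂ 0 = deriv φ₁ 0 := dslope_same _ _
    rw [this]
    ring
  have hd1 : φ₁ 0 = deriv f 0 := dslope_same _ _
  have hexp : f ζ - (deriv f 0 * ζ + deriv (deriv f) 0 / 2 * ζ ^ 2) = φ₃ ζ * ζ ^ 3 := by
    rw [hderiv2, ← hd1, e1 f ζ, h0, show dslope f 0 ζ = φ₁ ζ from rfl, e1 φ₁ ζ,
      show dslope φ₁ 0 ζ = φ₂ ζ from rfl, e1 φ₂ ζ]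
    ring
  rw [hexp, norm_mul, norm_pow]
  refine mul_le_mul_of_nonneg_right ((hb3.2 ζ hζ).trans (le_of_eq ?_)) (by positivity)
  field_simp
  norm_num

/-- `L x` is the germ at `x` of the holomorphic lift of `g`, as a map of displacements:
`x + ζ` is mapped to `G x + L x ζ`. Its domain and its Taylor remainder are uniform in `x`. -/
structure LocalLift (G D N : ℝ → ℝ) (V : Set ℂ) (g : ℂ → ℂ) (L : ℝ → ℂ → ℂ) (Δ K : ℝ) :
    Prop where
  mem : ∀ (x : ℝ) (ζ : ℂ), ‖ζ‖ < Δ → E (x + ζ) ∈ V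
  lift : ∀ (x : ℝ) (ζ : ℂ), ‖ζ‖ < Δ → E (G x + L x ζ) = g (E (x + ζ))
  taylor : ∀ (x : ℝ) (ζ : ℂ), ‖ζ‖ < Δ →
    ‖L x ζ - D x * (ζ + N x / 2 * ζ ^ 2)‖ ≤ K * D x * ‖ζ‖ ^ 3

lemma exists_localLift {G : CircleDeg1Lift} {D N σ : ℝ → ℝ} {B : ℝ} (hG : SmoothLift G D N σ B)
    {V : Set ℂ} {g : ℂ → ℂ} (hg : IsHolomorphicExtension G V g) :
    ∃ Δ > 0, ∃ K > 0, ∃ L : ℝ → ℂ → ℂ, LocalLift G D N V g L Δ K := by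
  have hDc : Continuous D :=
    continuous_iff_continuousAt.2 fun x => (hG.hasDerivAt_deriv x).continuousAt
  obtain ⟨x₁, hx₁⟩ := exists_forall_le_of_periodic hDc fun x k => by
    simpa using (Function.Periodic.int_mul (f := D) (c := 1) hG.deriv_add_one k) x
  obtain ⟨b, hb⟩ := exists_bound_of_periodic hDc hG.deriv_add_one
  have hb0 : 0 < b := (hG.pos 0).trans_le (hb 0)
  -- Near the unit circle `g` is defined and close to its values on the circle.
  obtain ⟨r, hr, hrV⟩ : ∃ r > 0, ∀ (z w : ℂ), ‖z‖ = 1 → dist w z < r →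
      w ∈ V ∧ dist (g z) (g w) < 1 / 2 := by
    have hK : IsCompact (Metric.sphere (0 : ℂ) 1) := isCompact_sphere 0 1
    obtain ⟨r₁, hr₁, h1⟩ := hK.exists_thickening_subset_open hg.isOpen hg.circle_subset
    have h2 := hK.uniformContinuousAt_of_continuousAt g (fun z hz =>
      (hg.holomorphic.differentiableAt (hg.isOpen.mem_nhds (hg.circle_subset hz))).continuousAt)
      (Metric.dist_mem_uniformity (show (0 : ℝ) < 1 / 2 by norm_num))
    obtain ⟨r₂, hr₂, h2⟩ := Metric.mem_uniformity_dist.1 h2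
    refine ⟨min r₁ r₂, lt_min hr₁ hr₂, fun z w hz hw => ⟨h1 ?_, ?_⟩⟩
    · exact Metric.mem_thickening_iff.2 ⟨z, by simpa using hz, hw.trans_le (min_le_left _ _)⟩
    · refine h2 (a := z) (b := w) ?_ (by simpa using hz)
      rw [dist_comm]
      exact hw.trans_le (min_le_right _ _)
  obtain ⟨Δ₁, hΔ₁, hE⟩ : ∃ Δ₁ > 0, ∀ ζ : ℂ, ‖ζ‖ < Δ₁ → ‖E ζ - 1‖ < r := by
    obtain ⟨d, hd, h⟩ :=
      Metric.continuousAt_iff.1 (differentiable_E.continuous.continuousAt (x := 0)) r hr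
    refine ⟨d, hd, fun ζ hζ => ?_⟩
    have := h (x := ζ) (by simpa using hζ)
    rwa [E_zero, dist_eq_norm] at this
  set Δ := min Δ₁ (1 / (2 * b)) with hΔdef
  have hΔ : 0 < Δ := lt_min hΔ₁ (by positivity)
  have hnear : ∀ (x : ℝ) (ζ : ℂ), ‖ζ‖ < Δ → E (x + ζ) ∈ V ∧
      ‖g (E (x + ζ)) / g (E x) - 1‖ ≤ 1 / 2 := by
    intro x ζ hζ
    have h1 : dist (E (x + ζ)) (E x) < r := by
      rw [dist_eq_norm, E_add, ← mul_sub_one, norm_mul, norm_E_ofReal, one_mul]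
      exact hE ζ (hζ.trans_le (min_le_left _ _))
    obtain ⟨h2, h3⟩ := hrV (E x) (E (x + ζ)) (norm_E_ofReal x) h1
    refine ⟨h2, ?_⟩
    have hgx : ‖g (E x)‖ = 1 := by rw [hg.semiconj, norm_E_ofReal]
    have hgx0 : g (E x) ≠ 0 := by rw [← norm_ne_zero_iff, hgx]; exact one_ne_zero
    rw [div_sub_one hgx0, norm_div, hgx, div_one, ← dist_eq_norm, dist_comm]
    exact h3.le
  set L : ℝ → ℂ → ℂ := fun x ζ =>
    Complex.log (g (E (x + ζ)) / g (E x)) / (2 * Real.pi * Complex.I) with hL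
  have hpi : (2 * Real.pi * Complex.I : ℂ) ≠ 0 := Complex.two_pi_I_ne_zero
  have hslit : ∀ (x : ℝ) (ζ : ℂ), ‖ζ‖ < Δ → g (E (x + ζ)) / g (E x) ∈ Complex.slitPlane := by
    intro x ζ hζ
    apply Complex.ball_one_subset_slitPlane
    rw [mem_ball_iff_norm]
    exact (hnear x ζ hζ).2.trans_lt (by norm_num)
  have hLlift : ∀ (x : ℝ) (ζ : ℂ), ‖ζ‖ < Δ → E (G x + L x ζ) = g (E (x + ζ)) := by
    intro x ζ hζ
    have hgx0 : g (E x) ≠ 0 := by rw [hg.semiconj]; exact E_ne_zero _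
    have : E (L x ζ) = g (E (x + ζ)) / g (E x) := by
      rw [E, hL]
      simp only
      rw [mul_div_cancel₀ _ hpi, Complex.exp_log (Complex.slitPlane_ne_zero (hslit x ζ hζ))]
    rw [E_add, this, ← hg.semiconj, mul_div_cancel₀ _ hgx0]
  have hLreal : ∀ x s : ℝ, |s| < Δ → L x s = ((G (x + s) - G x : ℝ) : ℂ) := by
    intro x s hs
    have hlip : |G (x + s) - G x| ≤ b * |s| := by
      have := convex_univ.norm_image_sub_le_of_norm_hasDerivWithin_le (f := G) (f' := D) (C := b)
        (fun x _ => (hG.hasDerivAt x).hasDerivWithinAt)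
        (fun x _ => by rw [Real.norm_eq_abs, abs_of_pos (hG.pos x)]; exact hb x)
        (Set.mem_univ x) (Set.mem_univ (x + s))
      simpa using this
    have hlt : |G (x + s) - G x| < 1 / 2 := by
      have h1 : |s| < 1 / (2 * b) := hs.trans_le (min_le_right _ _)
      rw [lt_div_iff₀ (by positivity)] at h1
      linarith
    have hexp : g (E (x + s)) / g (E x) =
        Complex.exp (((2 * Real.pi * (G (x + s) - G x) : ℝ) : ℂ) * Complex.I) := by
      have h1 := hg.semiconj (x + s)
      push_cast at h1
      rw [h1, hg.semiconj, ← E_sub, E]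
      push_cast
      congr 1
      ring
    simp only [hL]
    rw [hexp, Complex.log_exp]
    · rw [div_eq_iff hpi]
      push_cast
      ring
    · have := (abs_lt.1 hlt).1
      simp only [Complex.mul_I_im, Complex.ofReal_re]
      nlinarith [Real.pi_pos]
    · have := (abs_lt.1 hlt).2
      simp only [Complex.mul_I_im, Complex.ofReal_re]
      nlinarith [Real.pi_pos]
  have hLdiff : ∀ x : ℝ, DifferentiableOn ℂ (L x) (Metric.ball 0 Δ) := by
    intro x
    refine DifferentiableOn.div_const (DifferentiableOn.clog ?_ ?_) _
    · refine DifferentiableOn.div_const ?_ _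
      refine hg.holomorphic.comp (t := V)
        ((differentiable_E.comp (differentiable_id.const_add (x : ℂ))).differentiableOn) ?_
      intro ζ hζ
      exact (hnear x ζ (by simpa using hζ)).1
    · intro ζ hζ
      exact hslit x ζ (by simpa using hζ)
  have hLbound : ∀ (x : ℝ), ∀ ζ ∈ Metric.ball (0 : ℂ) Δ, ‖L x ζ‖ ≤ 1 := by
    intro x ζ hζ
    have h1 := (hnear x ζ (by simpa using hζ)).2
    have h2 := Complex.norm_log_one_add_half_le_self h1
    rw [add_sub_cancel] at h2
    simp only [hL]
    rw [norm_div, div_le_one (norm_pos_iff.2 hpi)]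
    have h3 : ‖(2 * Real.pi * Complex.I : ℂ)‖ = 2 * Real.pi := by
      simp [abs_of_pos Real.pi_pos]
    rw [h3]
    linarith [Real.pi_gt_three]
  have hderiv : ∀ x s : ℝ, |s| < Δ → deriv (L x) s = (D (x + s) : ℂ) := by
    intro x s hs
    have hmem : Metric.ball (0 : ℂ) Δ ∈ nhds (s : ℂ) :=
      Metric.isOpen_ball.mem_nhds (by simpa using hs)
    have h1 : HasDerivAt (fun t : ℝ => L x t) (deriv (L x) s) s :=
      ((hLdiff x).differentiableAt hmem).hasDerivAt.comp_ofReal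
    have h2 : HasDerivAt (fun t : ℝ => ((G (x + t) - G x : ℝ) : ℂ)) (D (x + s) : ℂ) s :=
      (((hG.hasDerivAt (x + s)).comp_const_add x s).sub_const (G x)).ofReal_comp
    refine h1.unique (h2.congr_of_eventuallyEq ?_)
    filter_upwards [(isOpen_lt continuous_abs continuous_const).mem_nhds hs] with t ht
    exact hLreal x t ht
  have hderiv2 : ∀ x : ℝ, deriv (deriv (L x)) 0 = (D x * N x : ℂ) := by
    intro x
    have hA : AnalyticAt ℂ (L x) 0 := (hLdiff x).analyticAt (Metric.ball_mem_nhds 0 hΔ)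
    have h0 : HasDerivAt (deriv (L x)) (deriv (deriv (L x)) 0) ((0 : ℝ) : ℂ) := by
      rw [Complex.ofReal_zero]
      exact hA.deriv.differentiableAt.hasDerivAt
    have h1 := h0.comp_ofReal
    have h2 : HasDerivAt (fun t : ℝ => (D (x + t) : ℂ)) ((D x * N x : ℝ) : ℂ) 0 := by
      have := ((hG.hasDerivAt_deriv (x + 0)).comp_const_add x 0).ofReal_comp
      rwa [add_zero] at this
    rw [← Complex.ofReal_mul]
    refine h1.unique (h2.congr_of_eventuallyEq ?_)
    filter_upwards [(isOpen_lt continuous_abs continuous_const).mem_nhds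
      (show |(0 : ℝ)| < Δ by simpa using hΔ)] with t ht
    exact hderiv x t ht
  have hD1 := hG.pos x₁
  refine ⟨Δ, hΔ, 4 / Δ ^ 3 / D x₁, by positivity, L, fun x ζ hζ => (hnear x ζ hζ).1, hLlift,
    fun x ζ hζ => ?_⟩
  have h0 : L x 0 = 0 := by
    have := hLreal x 0 (by simpa using hΔ)
    simpa using this
  have h1 := norm_sub_taylor_le hΔ (hLdiff x) h0 (hLbound x) (ζ := ζ) (by simpa using hζ)
  have h2 : deriv (L x) 0 = D x := by
    have := hderiv x 0 (by simpa using hΔ)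
    simpa using this
  rw [h2, hderiv2] at h1
  have h3 : (D x : ℂ) * ζ + D x * N x / 2 * ζ ^ 2 = D x * (ζ + N x / 2 * ζ ^ 2) := by ring
  rw [h3] at h1
  refine h1.trans (mul_le_mul_of_nonneg_right ?_ (by positivity))
  rw [div_mul_eq_mul_div, le_div_iff₀ hD1]
  exact mul_le_mul_of_nonneg_left (hx₁ x) (by positivity)

/-- In the coordinate `1 / ζ` a single step is a translation by half the nonlinearity, up to an
error of order `ζ`. -/
lemma LocalLift.norm_div_sub_le {G D N σ : ℝ → ℝ} {B : ℝ} (hG : SmoothLift G D N σ B) {V : Set ℂ}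
    {g : ℂ → ℂ} {L : ℝ → ℂ → ℂ} {Δ K : ℝ} (hΔ : 0 < Δ) (hK : 0 < K)
    (hL : LocalLift G D N V g L Δ K) :
    ∃ Δ' > 0, Δ' ≤ Δ ∧ ∃ K' > 0, ∀ (x : ℝ) (ζ : ℂ), ζ ≠ 0 → ‖ζ‖ < Δ' →
      L x ζ ≠ 0 ∧ ‖D x / L x ζ - (1 / ζ - N x / 2)‖ ≤ K' * ‖ζ‖ := by
  have hB := hG.bound_nonneg
  set Δ' := min (min Δ 1) (1 / (2 * (B + K + 1)))
  have hΔ' : 0 < Δ' := lt_min (lt_min hΔ one_pos) (by positivity)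
  refine ⟨Δ', hΔ', (min_le_left _ _).trans (min_le_left _ _), 2 * (B ^ 2 + B * K + K),
    by positivity, fun x ζ hζ0 hζ => ?_⟩
  have hζΔ : ‖ζ‖ < Δ := hζ.trans_le ((min_le_left _ _).trans (min_le_left _ _))
  have hζ1 : ‖ζ‖ < 1 := hζ.trans_le ((min_le_left _ _).trans (min_le_right _ _))
  have hζ2 : ‖ζ‖ * (2 * (B + K + 1)) < 1 := by
    rw [← lt_div_iff₀ (by positivity)]
    exact hζ.trans_le (min_le_right _ _)
  have hζp : 0 < ‖ζ‖ := norm_pos_iff.2 hζ0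
  have hD := hG.pos x
  have hD0 : (D x : ℂ) ≠ 0 := by exact_mod_cast hD.ne'
  have hN : ‖(N x : ℂ)‖ ≤ B := by
    rw [Complex.norm_real]
    exact hG.nonlin_le x
  set F := L x ζ / D x with hF
  set R := F - (ζ + N x / 2 * ζ ^ 2) with hR
  have hRle : ‖R‖ ≤ K * ‖ζ‖ ^ 3 := by
    have h1 := hL.taylor x ζ hζΔ
    have h2 : R = (L x ζ - D x * (ζ + N x / 2 * ζ ^ 2)) / D x := by
      rw [hR, hF, sub_div, mul_div_cancel_left₀ _ hD0]
    rw [h2, norm_div, Complex.norm_real, Real.norm_eq_abs, abs_of_pos hD, div_le_iff₀ hD]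
    linarith
  have hN2 : ‖(N x / 2 : ℂ)‖ ≤ B / 2 := by
    rw [norm_div, Complex.norm_two]
    linarith
  have hFlow : ‖ζ‖ / 2 ≤ ‖F‖ := by
    have h1 : ‖F - ζ‖ ≤ ‖ζ‖ / 2 := by
      have e : F - ζ = N x / 2 * ζ ^ 2 + R := by rw [hR]; ring
      rw [e]
      refine (norm_add_le _ _).trans ?_
      rw [norm_mul, norm_pow]
      have a1 : ‖(N x / 2 : ℂ)‖ * ‖ζ‖ ^ 2 ≤ B / 2 * ‖ζ‖ ^ 2 := by gcongr
      have a2 : K * ‖ζ‖ ^ 3 ≤ K * ‖ζ‖ ^ 2 := by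
        gcongr ?_ * ?_
        exact pow_le_pow_of_le_one hζp.le hζ1.le (by norm_num)
      nlinarith
    have h2 := norm_sub_norm_le ζ F
    rw [norm_sub_rev] at h2
    linarith
  have hF0 : F ≠ 0 := norm_pos_iff.1 (by linarith)
  have hL0 : L x ζ ≠ 0 := fun h => hF0 (by rw [hF, h, zero_div])
  refine ⟨hL0, ?_⟩
  have hid : D x / L x ζ - (1 / ζ - N x / 2) =
      ((N x / 2) ^ 2 * ζ ^ 3 + N x / 2 * (ζ * R) - R) / (ζ * F) := by
    have h1 : (D x : ℂ) / L x ζ = 1 / F := by rw [hF, one_div_div]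
    have h2 : R = F - (ζ + N x / 2 * ζ ^ 2) := hR
    rw [h1, h2]
    field_simp
    ring
  rw [hid, norm_div, norm_mul, div_le_iff₀ (by positivity)]
  have hnum : ‖((N x / 2) ^ 2 * ζ ^ 3 + N x / 2 * (ζ * R) - R : ℂ)‖ ≤
      (B ^ 2 + B * K + K) * ‖ζ‖ ^ 3 := by
    refine (norm_sub_le _ _).trans ((add_le_add_left (norm_add_le _ _) _).trans ?_)
    rw [norm_mul, norm_mul, norm_mul, norm_pow, norm_pow]
    have a1 : ‖(N x / 2 : ℂ)‖ ^ 2 * ‖ζ‖ ^ 3 ≤ (B / 2) ^ 2 * ‖ζ‖ ^ 3 := by gcongr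
    have a2 : ‖(N x / 2 : ℂ)‖ * (‖ζ‖ * ‖R‖) ≤ B / 2 * (1 * (K * ‖ζ‖ ^ 3)) := by gcongr
    have a3 : 0 ≤ B ^ 2 * ‖ζ‖ ^ 3 := by positivity
    have a4 : 0 ≤ B * K * ‖ζ‖ ^ 3 := by positivity
    nlinarith
  refine hnum.trans ?_
  calc (B ^ 2 + B * K + K) * ‖ζ‖ ^ 3 =
        2 * (B ^ 2 + B * K + K) * ‖ζ‖ * (‖ζ‖ * (‖ζ‖ / 2)) := by ring
    _ ≤ _ := by gcongr

/-! ### Complex orbits -/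

/-- The displacement of the `j`-th iterate of `x + ζ` under the holomorphic lift from the `j`-th
iterate of the real point `x`. -/
def dispIter (G : ℝ → ℝ) (L : ℝ → ℂ → ℂ) (x : ℝ) (ζ : ℂ) : ℕ → ℂ
  | 0 => ζ
  | j + 1 => L (G^[j] x) (dispIter G L x ζ j)

/-- The reciprocals of the normalized displacements `ζ_j / (G^j)'(x)` move by half the nonlinearity
of `G^j`, which is small at this scale, and by a small accumulated error. -/
lemma dispIter_estimate {G D N σ : ℝ → ℝ} {B : ℝ} (hG : SmoothLift G D N σ B) {H : ℝ ≃o ℝ} {θ : ℝ}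
    {Q : ℕ} {C δ : ℝ} (hS : ScaleEstimates G D N H θ Q C δ) {L : ℝ → ℂ → ℂ} {Δ K y₀ : ℝ}
    (hK : 0 < K) (hy₀ : 0 < y₀)
    (hstep : ∀ (x : ℝ) (ζ : ℂ), ζ ≠ 0 → ‖ζ‖ < Δ →
      L x ζ ≠ 0 ∧ ‖D x / L x ζ - (1 / ζ - N x / 2)‖ ≤ K * ‖ζ‖)
    (hδ1 : y₀ * δ / 2 + 2 * K * y₀ ^ 2 * δ ≤ 1 / 2) (hδ2 : 2 * y₀ * δ < Δ)
    {x : ℝ} {ζ : ℂ} (hζ0 : ζ ≠ 0) (hζ : ‖ζ‖ ≤ y₀ * gap H θ x) {j : ℕ} (hj : j ≤ Q) :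
    dispIter G L x ζ j ≠ 0 ∧ ‖dispIter G L x ζ j‖ < Δ ∧
      ‖ζ * derivIter G D j x / dispIter G L x ζ j - 1‖ ≤
        y₀ * δ / 2 + 2 * K * y₀ ^ 2 * δ := by
  have hζp : 0 < ‖ζ‖ := norm_pos_iff.2 hζ0
  have hg0 : 0 ≤ gap H θ x := abs_nonneg _
  -- The explicit form of the estimate, from which the other bounds follow.
  have hcons : ∀ i ≤ Q, dispIter G L x ζ i ≠ 0 →
      ‖derivIter G D i x / dispIter G L x ζ i - (1 / ζ - nonlinIter G D N i x / 2)‖ ≤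
        2 * K * ‖ζ‖ * ∑ k ∈ Finset.range i, derivIter G D k x ^ 2 →
      ‖ζ * derivIter G D i x / dispIter G L x ζ i - 1‖ ≤ y₀ * δ / 2 + 2 * K * y₀ ^ 2 * δ ∧
        ‖dispIter G L x ζ i‖ ≤ 2 * (derivIter G D i x * ‖ζ‖) := by
    intro i hi hne h
    set u := dispIter G L x ζ i
    set d := derivIter G D i x
    set w := nonlinIter G D N i x
    have hd : 0 < d := hG.derivIter_pos i x
    have h1 : ‖ζ * d / u - 1‖ ≤ y₀ * δ / 2 + 2 * K * y₀ ^ 2 * δ := by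
      have e : ζ * d / u - 1 = ζ * (d / u - (1 / ζ - w / 2)) + -(ζ * (w / 2)) := by
        field_simp
        ring
      rw [e]
      refine (norm_add_le _ _).trans ?_
      rw [norm_neg, norm_mul, norm_mul, norm_div, Complex.norm_real, Real.norm_eq_abs,
        Complex.norm_two, add_comm]
      refine add_le_add ?_ ?_
      · have a1 := hS.abs_nonlin_le i hi x
        calc ‖ζ‖ * (|w| / 2) ≤ y₀ * gap H θ x * (|w| / 2) := by gcongr
          _ = y₀ * (|w| * gap H θ x) / 2 := by ring
          _ ≤ _ := by gcongr
      · have a2 := hS.sum_sq_le i hi x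
        have hs : 0 ≤ ∑ k ∈ Finset.range i, derivIter G D k x ^ 2 :=
          Finset.sum_nonneg fun _ _ => sq_nonneg _
        calc _ ≤ ‖ζ‖ * (2 * K * ‖ζ‖ * ∑ k ∈ Finset.range i, derivIter G D k x ^ 2) := by gcongr
          _ = 2 * K * ‖ζ‖ ^ 2 * ∑ k ∈ Finset.range i, derivIter G D k x ^ 2 := by ring
          _ ≤ 2 * K * (y₀ * gap H θ x) ^ 2 * ∑ k ∈ Finset.range i, derivIter G D k x ^ 2 := by
              gcongr
          _ = 2 * K * y₀ ^ 2 *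
              ((∑ k ∈ Finset.range i, derivIter G D k x ^ 2) * gap H θ x ^ 2) := by ring
          _ ≤ _ := by gcongr
    refine ⟨h1, ?_⟩
    have h2 : 1 / 2 ≤ ‖ζ * d / u‖ := by
      have := norm_sub_norm_le (1 : ℂ) (ζ * d / u)
      rw [norm_sub_rev, norm_one] at this
      linarith
    have hu : 0 < ‖u‖ := norm_pos_iff.2 hne
    rw [norm_div, norm_mul, Complex.norm_real, Real.norm_eq_abs, abs_of_pos hd, le_div_iff₀ hu]
      at h2
    linarith
  have hsmall : ∀ i ≤ Q, ‖dispIter G L x ζ i‖ ≤ 2 * (derivIter G D i x * ‖ζ‖) →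
      ‖dispIter G L x ζ i‖ < Δ := by
    intro i hi h
    refine (h.trans ?_).trans_lt hδ2
    have h1 := hS.derivIter_mul_gap_le i hi x
    have h2 := hG.derivIter_pos i x
    calc _ ≤ 2 * (derivIter G D i x * (y₀ * gap H θ x)) := by gcongr
      _ = 2 * y₀ * (derivIter G D i x * gap H θ x) := by ring
      _ ≤ _ := by gcongr
  have key : ∀ i ≤ Q, dispIter G L x ζ i ≠ 0 ∧
      ‖derivIter G D i x / dispIter G L x ζ i - (1 / ζ - nonlinIter G D N i x / 2)‖ ≤
        2 * K * ‖ζ‖ * ∑ k ∈ Finset.range i, derivIter G D k x ^ 2 := by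
    intro i
    induction i with
    | zero =>
      intro _
      refine ⟨hζ0, ?_⟩
      simp [dispIter, derivIter, nonlinIter]
    | succ i ih =>
      intro hi
      obtain ⟨h1, h2⟩ := ih (by omega)
      obtain ⟨-, h4⟩ := hcons i (by omega) h1 h2
      have h5 := hsmall i (by omega) h4
      obtain ⟨h6, h7⟩ := hstep (G^[i] x) _ h1 h5
      refine ⟨h6, ?_⟩
      have hd := hG.derivIter_pos i x
      rw [Finset.sum_range_succ, derivIter_succ, nonlinIter_succ]
      change ‖((derivIter G D i x * D (G^[i] x) : ℝ) : ℂ) /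
        L (G^[i] x) (dispIter G L x ζ i) - _‖ ≤ _
      push_cast
      set u := dispIter G L x ζ i
      set d := derivIter G D i x
      have e : (d * D (G^[i] x) : ℂ) / L (G^[i] x) u -
          (1 / ζ - (nonlinIter G D N i x + N (G^[i] x) * d) / 2) =
          d * (D (G^[i] x) / L (G^[i] x) u - (1 / u - N (G^[i] x) / 2)) +
            (d / u - (1 / ζ - nonlinIter G D N i x / 2)) := by
        ring
      rw [e]
      refine (norm_add_le _ _).trans ?_
      rw [norm_mul, Complex.norm_real, Real.norm_eq_abs, abs_of_pos hd]
      have h8 : d * ‖(D (G^[i] x) : ℂ) / L (G^[i] x) u - (1 / u - N (G^[i] x) / 2)‖ ≤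
          d * (K * (2 * (d * ‖ζ‖))) := by
        gcongr
        exact h7.trans (by gcongr)
      nlinarith
  obtain ⟨h1, h2⟩ := key j hj
  obtain ⟨h3, h4⟩ := hcons j hj h1 h2
  exact ⟨h1, hsmall j hj h4, h3⟩

lemma iterate_E_ofReal {G : CircleDeg1Lift} {V : Set ℂ} {g : ℂ → ℂ}
    (hg : IsHolomorphicExtension G V g) (j : ℕ) (x : ℝ) : g^[j] (E x) = E (G^[j] x : ℝ) := by
  induction j with
  | zero => rfl
  | succ j ih => rw [Function.iterate_succ_apply', ih, hg.semiconj, Function.iterate_succ_apply']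

lemma LocalLift.iterate_E {G D N : ℝ → ℝ} {V : Set ℂ} {g : ℂ → ℂ} {L : ℝ → ℂ → ℂ} {Δ K : ℝ}
    (hL : LocalLift G D N V g L Δ K) {Q : ℕ} {x : ℝ} {ζ : ℂ}
    (h : ∀ j ≤ Q, ‖dispIter G L x ζ j‖ < Δ) {j : ℕ} (hj : j ≤ Q) :
    g^[j] (E (x + ζ)) = E ((G^[j] x : ℝ) + dispIter G L x ζ j) := by
  induction j with
  | zero => rfl
  | succ j ih =>
    rw [Function.iterate_succ_apply', ih (by omega), ← hL.lift _ _ (h j (by omega)),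
      Function.iterate_succ_apply']
    rfl

lemma abs_sub_one_le_of_abs_log_le {r δ : ℝ} (hr : 0 < r) (hδ : δ ≤ 1) (h : |Real.log r| ≤ δ) :
    |r - 1| ≤ 2 * δ := by
  have := Real.abs_exp_sub_one_le (h.trans hδ)
  rw [Real.exp_log hr] at this
  linarith

/-- After `j` steps the orbit of the point at height `y₀ · gap` below `x` is, relative to its
height, close to the point at height `y₀ · gap` below `G^j x`. -/
lemma norm_dispIter_sub_le {G D N : ℝ → ℝ} {H : ℝ ≃o ℝ} {θ : ℝ} {Q : ℕ} {C δ : ℝ}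
    (hS : ScaleEstimates G D N H θ Q C δ) (hθ : θ ≠ 0) {L : ℝ → ℂ → ℂ} {κ y₀ : ℝ} (hy₀ : 0 < y₀)
    (hδ : δ ≤ 1 / 2) (hκ : κ ≤ 1 / 2) {x : ℝ} {j : ℕ} (hj : j ≤ Q) (hd : 0 < derivIter G D j x)
    {ζ : ℂ} (hζ : ζ = -(Complex.I * (y₀ * gap H θ x : ℝ))) (hne : dispIter G L x ζ j ≠ 0)
    (h : ‖ζ * derivIter G D j x / dispIter G L x ζ j - 1‖ ≤ κ) :
    ‖dispIter G L x ζ j + Complex.I * (y₀ * gap H θ (G^[j] x) : ℝ)‖ ≤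
      (4 * κ + 2 * δ) * (y₀ * gap H θ (G^[j] x)) := by
  set u := dispIter G L x ζ j
  set d := derivIter G D j x
  set s := gap H θ x
  set t := gap H θ (G^[j] x)
  have hs : 0 < s := gap_pos H hθ x
  have ht : 0 < t := gap_pos H hθ _
  set A := ζ * d / u
  have hζ0 : ζ ≠ 0 := by
    rw [hζ, neg_ne_zero]
    exact mul_ne_zero Complex.I_ne_zero (by exact_mod_cast (mul_pos hy₀ hs).ne')
  have hd0 : (d : ℂ) ≠ 0 := by exact_mod_cast hd.ne'
  have hA0 : A ≠ 0 := div_ne_zero (mul_ne_zero hζ0 hd0) hne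
  have hA1 : 1 / 2 ≤ ‖A‖ := by
    have := norm_sub_norm_le (1 : ℂ) A
    rw [norm_sub_rev, norm_one] at this
    linarith
  have hAinv : ‖1 / A - 1‖ ≤ 2 * κ := by
    have e : 1 / A - 1 = -(A - 1) / A := by field_simp; ring
    rw [e, norm_div, norm_neg, div_le_iff₀ (by linarith)]
    nlinarith [norm_nonneg (A - 1)]
  have hκ0 : 0 ≤ κ := (norm_nonneg _).trans h
  have hr : |d * s / t - 1| ≤ 2 * δ := by
    refine abs_sub_one_le_of_abs_log_le (by positivity) (by linarith) ?_
    rw [Real.log_div (by positivity) ht.ne', abs_sub_comm]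
    exact hS.gap_iterate j hj x
  have hr2 : d * s / t ≤ 2 := by linarith [(abs_le.1 hr).2]
  have e : u + Complex.I * (y₀ * t : ℝ) =
      -(Complex.I * (y₀ * t : ℝ)) *
        ((d * s / t : ℝ) * (1 / A - 1) + ((d * s / t - 1 : ℝ) : ℂ)) := by
    have hu : u = ζ * d * (1 / A) := by
      simp only [A]
      field_simp
    have ht0 : (t : ℂ) ≠ 0 := by exact_mod_cast ht.ne'
    rw [hu, hζ]
    push_cast
    field_simp
    ring
  rw [e, norm_mul, norm_neg, norm_mul, Complex.norm_I, one_mul, Complex.norm_real,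
    Real.norm_eq_abs, abs_of_pos (mul_pos hy₀ ht), mul_comm]
  refine mul_le_mul_of_nonneg_right ?_ (by positivity)
  refine (norm_add_le _ _).trans ?_
  rw [norm_mul, Complex.norm_real, Complex.norm_real, Real.norm_eq_abs, Real.norm_eq_abs,
    abs_of_pos (show 0 < d * s / t by positivity)]
  have : d * s / t * ‖1 / A - 1‖ ≤ 2 * (2 * κ) := by gcongr
  linarith

/-! ### Hyperbolic distance in the exterior of the disk -/

lemma dP_E_le {z w : ℂ} (hz : z.im < 0) (hw : w.im < 0) :
    dP (E z) (E w) ≤ ENNReal.ofReal (‖z - w‖ / √(z.im * w.im)) := by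
  set z' : ℍ := ⟨-z, by simpa using hz⟩
  set w' : ℍ := ⟨-w, by simpa using hw⟩
  have h1 : extCover z' = E z := by
    change E (-(-z)) = E z
    rw [neg_neg]
  have h2 : extCover w' = E w := by
    change E (-(-w)) = E w
    rw [neg_neg]
  refine (iInf_le_of_le z' (iInf_le_of_le w' (iInf_le_of_le h1 (iInf_le _ h2)))).trans ?_
  rw [edist_dist]
  refine ENNReal.ofReal_le_ofReal ?_
  rw [UpperHalfPlane.dist_eq]
  have e1 : dist (z' : ℂ) w' = ‖z - w‖ := by
    change dist (-z) (-w) = _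
    rw [dist_neg_neg, dist_eq_norm]
  have e2 : z'.im * w'.im = z.im * w.im := by
    change (-z).im * (-w).im = _
    simp
  rw [e1, e2]
  have h0 : 0 ≤ ‖z - w‖ / (2 * √(z.im * w.im)) := by positivity
  have h3 : Real.arsinh (‖z - w‖ / (2 * √(z.im * w.im))) ≤ ‖z - w‖ / (2 * √(z.im * w.im)) := by
    rw [← Real.sinh_le_sinh, Real.sinh_arsinh]
    exact Real.self_le_sinh_iff.2 h0
  calc _ ≤ 2 * (‖z - w‖ / (2 * √(z.im * w.im))) := by linarith
    _ = _ := by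
      rw [mul_comm (2 : ℝ) (√_), ← div_div]
      ring

lemma dP_comm (z w : ℂ) : dP z w = dP w z := by
  unfold dP
  rw [iInf_comm]
  refine iInf_congr fun w' => iInf_congr fun z' => ?_
  rw [iInf_comm, edist_comm]

/-- A point whose Euclidean distance from a reference point is at most `s ≤ 1 / 2` times the height
of that point lies within hyperbolic distance `2 s` of it. -/
lemma dP_E_le_of_norm_le {x t s : ℝ} (ht : 0 < t) (hs : s ≤ 1 / 2) {ζ : ℂ}
    (h : ‖ζ + Complex.I * (t : ℝ)‖ ≤ s * t) :
    1 < ‖E (x + ζ)‖ ∧ dP (E (x + ζ)) (E (x + -(Complex.I * (t : ℝ)))) ≤ ENNReal.ofReal (2 * s) := by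
  have hre : |ζ.im + t| ≤ s * t := by
    have := (Complex.abs_im_le_norm (ζ + Complex.I * (t : ℝ))).trans h
    simpa using this
  have him : ζ.im ≤ -(t / 2) := by nlinarith [(abs_le.1 hre).2]
  have e1 : ((x : ℂ) + ζ).im = ζ.im := by simp
  have e2 : ((x : ℂ) + -(Complex.I * (t : ℝ))).im = -t := by simp
  refine ⟨?_, (dP_E_le (by rw [e1]; linarith) (by rw [e2]; linarith)).trans
    (ENNReal.ofReal_le_ofReal ?_)⟩
  · rw [norm_E, e1, Real.one_lt_exp_iff]
    nlinarith [Real.pi_pos]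
  · have e3 : (x : ℂ) + ζ - (x + -(Complex.I * (t : ℝ))) = ζ + Complex.I * (t : ℝ) := by ring
    rw [e1, e2, e3]
    have h1 : t / 2 ≤ √(ζ.im * -t) := by
      refine Real.le_sqrt_of_sq_le ?_
      nlinarith
    rw [div_le_iff₀ (by linarith)]
    have hs0 : 0 ≤ s := by
      by_contra hneg
      push Not at hneg
      nlinarith [norm_nonneg (ζ + Complex.I * (t : ℝ))]
    nlinarith

/-! ### The curve below the graph of a periodic function -/

lemma E_eq_E_iff {z w : ℂ} : E z = E w ↔ ∃ k : ℤ, z = w + k := by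
  have hpi : (2 * Real.pi * Complex.I : ℂ) ≠ 0 := Complex.two_pi_I_ne_zero
  rw [E, E, Complex.exp_eq_exp_iff_exists_int]
  refine exists_congr fun k => ?_
  have e : (2 * Real.pi * Complex.I * w + k * (2 * Real.pi * Complex.I) : ℂ) =
      2 * Real.pi * Complex.I * (w + k) := by ring
  rw [e]
  exact mul_right_inj' hpi

/-- The point of the exterior of the disk over the point at depth `t` below the real point `x`. -/
noncomputable def extPoint (x t : ℝ) : ℂ := E (x + -(Complex.I * (t : ℝ)))

lemma norm_extPoint (x t : ℝ) : ‖extPoint x t‖ = Real.exp (2 * Real.pi * t) := by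
  rw [extPoint, norm_E]
  congr 1
  simp

lemma extPoint_zero (x : ℝ) : extPoint x 0 = E x := by simp [extPoint]

lemma extPoint_eq (x t : ℝ) : extPoint x t = E x * (Real.exp (2 * Real.pi * t) : ℝ) := by
  have h : E (-(Complex.I * (t : ℝ))) = (Real.exp (2 * Real.pi * t) : ℝ) := by
    rw [E, Complex.ofReal_exp]
    congr 1
    push_cast
    linear_combination (-2 * Real.pi * t : ℂ) * Complex.I_sq
  rw [extPoint, E_add, h]

lemma continuous_extPoint : Continuous fun p : ℝ × ℝ => extPoint p.1 p.2 := by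
  refine differentiable_E.continuous.comp ?_
  fun_prop

lemma extPoint_add_int (x t : ℝ) (k : ℤ) : extPoint (x + k) t = extPoint x t := by
  have e : ((x + k : ℝ) : ℂ) + -(Complex.I * (t : ℝ)) = (x + -(Complex.I * (t : ℝ))) + k := by
    push_cast
    ring
  rw [extPoint, e, E_add_int, extPoint]

lemma extPoint_eq_extPoint {x x' t t' : ℝ} (h : extPoint x t = extPoint x' t') :
    (∃ k : ℤ, x = x' + k) ∧ t = t' := by
  obtain ⟨k, hk⟩ := E_eq_E_iff.1 h
  have h1 := congrArg Complex.re hk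
  have h2 := congrArg Complex.im hk
  simp only [Complex.add_re, Complex.add_im, Complex.neg_re, Complex.neg_im, Complex.I_mul_re,
    Complex.I_mul_im, Complex.ofReal_re, Complex.ofReal_im, Complex.intCast_re,
    Complex.intCast_im] at h1 h2
  exact ⟨⟨k, by linarith⟩, by linarith⟩

lemma exists_extPoint_eq {z : ℂ} (hz : 1 < ‖z‖) : ∃ x ∈ Set.Icc (0 : ℝ) 1, ∃ t > 0,
    extPoint x t = z := by
  have hz0 : z ≠ 0 := norm_pos_iff.1 (one_pos.trans hz)
  have hpi : (2 * Real.pi * Complex.I : ℂ) ≠ 0 := Complex.two_pi_I_ne_zero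
  set w := Complex.log z / (2 * Real.pi * Complex.I)
  have hw : E w = z := by
    rw [E, mul_div_cancel₀ _ hpi, Complex.exp_log hz0]
  have him : w.im < 0 := by
    rw [← hw, norm_E, Real.one_lt_exp_iff] at hz
    nlinarith [Real.pi_pos]
  refine ⟨Int.fract w.re, ⟨Int.fract_nonneg _, (Int.fract_lt_one _).le⟩, -w.im, by linarith, ?_⟩
  have h1 := extPoint_add_int (Int.fract w.re) (-w.im) ⌊w.re⌋
  rw [Int.fract_add_floor] at h1
  rw [← h1, ← hw, extPoint]
  congr 1
  apply Complex.ext <;> simp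

/-- The region between the unit circle and the curve below the graph of `ρ`. -/
def regionBelow (ρ : ℝ → ℝ) : Set ℂ :=
  {z | ∃ x t : ℝ, 0 ≤ t ∧ t ≤ ρ x ∧ extPoint x t = z}

lemma isClosed_regionBelow {ρ : ℝ → ℝ} (hρ : Continuous ρ) (h0 : ∀ x, 0 ≤ ρ x)
    (hp : ∀ (x : ℝ) (k : ℤ), ρ (x + k) = ρ x) : IsClosed (regionBelow ρ) := by
  have hc : Continuous fun p : ℝ × ℝ => extPoint p.1 (p.2 * ρ p.1) :=
    continuous_extPoint.comp (continuous_fst.prodMk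
      (continuous_snd.mul (hρ.comp continuous_fst)))
  have heq : regionBelow ρ = (fun p : ℝ × ℝ => extPoint p.1 (p.2 * ρ p.1)) ''
      (Set.Icc 0 1 ×ˢ Set.Icc 0 1) := by
    ext z
    constructor
    · rintro ⟨x, t, ht0, ht, rfl⟩
      have h1 := extPoint_add_int (Int.fract x) t ⌊x⌋
      have h2 := hp (Int.fract x) ⌊x⌋
      rw [Int.fract_add_floor] at h1 h2
      refine ⟨(Int.fract x, t / ρ x), ⟨⟨Int.fract_nonneg _, (Int.fract_lt_one _).le⟩,
        ⟨div_nonneg ht0 (h0 x), div_le_one_of_le₀ ht (h0 x)⟩⟩, ?_⟩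
      simp only
      rw [← h2, h1]
      rcases (h0 x).eq_or_lt with h | h
      · rw [← h, mul_zero]
        rw [← h] at ht
        rw [le_antisymm ht ht0]
      · rw [div_mul_cancel₀ _ h.ne']
    · rintro ⟨⟨x, s⟩, ⟨-, hs0, hs1⟩, rfl⟩
      exact ⟨x, s * ρ x, mul_nonneg hs0 (h0 x), mul_le_of_le_one_left (h0 x) hs1, rfl⟩
  rw [heq]
  exact ((isCompact_Icc.prod isCompact_Icc).image hc).isClosed

/-- From a point beyond the curve a radial ray escapes to infinity without meeting the curve. -/
lemma annulus_subset_regionBelow {ρ : ℝ → ℝ} (hp : ∀ (x : ℝ) (k : ℤ), ρ (x + k) = ρ x) :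
    annulus (Set.range fun x => extPoint x (ρ x)) ⊆ regionBelow ρ := by
  rintro z ⟨hz1, -, hzb⟩
  obtain ⟨x, -, t, ht, rfl⟩ := exists_extPoint_eq hz1
  by_cases htρ : t ≤ ρ x
  · exact ⟨x, t, ht.le, htρ, rfl⟩
  exfalso
  push Not at htρ
  set R := extPoint x '' Set.Ici t
  have hconn : IsPreconnected R := isPreconnected_Ici.image _
    (continuous_extPoint.comp (continuous_const.prodMk continuous_id)).continuousOn
  have hsub : R ⊆ (Set.range fun x => extPoint x (ρ x))ᶜ := by
    rintro _ ⟨t', ht', rfl⟩ ⟨x', hx'⟩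
    obtain ⟨⟨k, rfl⟩, h⟩ := extPoint_eq_extPoint hx'
    rw [hp] at h
    have : t ≤ t' := ht'
    linarith
  have hb := hzb.subset (hconn.subset_connectedComponentIn ⟨t, Set.self_mem_Ici, rfl⟩ hsub)
  obtain ⟨b, hb⟩ := isBounded_iff_forall_norm_le.1 hb
  have h1 := hb _ ⟨max t b, Set.mem_Ici.2 (le_max_left _ _), rfl⟩
  rw [norm_extPoint] at h1
  have h2 := Real.add_one_le_exp (2 * Real.pi * max t b)
  have h3 : max t b ≤ 2 * Real.pi * max t b := by
    have : 0 < max t b := lt_max_of_lt_left ht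
    nlinarith [Real.pi_gt_three]
  linarith [le_max_right t b]

/-- The curve below the graph of a positive periodic function is a Jordan curve. -/
lemma exists_exteriorJordanCurve {ρ : ℝ → ℝ} (hρ : Continuous ρ) (h0 : ∀ x, 0 < ρ x)
    (hp : ∀ (x : ℝ) (k : ℤ), ρ (x + k) = ρ x) :
    ∃ γ : C(Circle, ℂ), IsExteriorJordanCurve γ ∧
      Set.range γ = Set.range fun x => extPoint x (ρ x) := by
  have hper : Function.Periodic ρ 1 := fun x => by simpa using hp x 1
  let e := AddCircle.homeomorphCircle (T := 1) one_ne_zero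
  have he : ∀ x : ℝ, ((e (x : AddCircle (1 : ℝ)) : Circle) : ℂ) = E x := fun x => by
    rw [AddCircle.homeomorphCircle_apply, AddCircle.toCircle_apply_mk, Circle.coe_exp, E]
    congr 1
    push_cast
    ring
  let r : Circle → ℝ := fun w => hper.lift (e.symm w)
  have hr : ∀ x : ℝ, r (e (x : AddCircle (1 : ℝ))) = ρ x := fun x => by
    simp only [r, Homeomorph.symm_apply_apply]
    exact hper.lift_coe x
  have hrc : Continuous r := by
    refine Continuous.comp ?_ e.symm.continuous
    exact continuous_coinduced_dom.2 hρ
  have hsurj : ∀ w : Circle, ∃ x : ℝ, w = e (x : AddCircle (1 : ℝ)) := fun w => by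
    obtain ⟨x, hx⟩ := QuotientAddGroup.mk_surjective (e.symm w)
    exact ⟨x, by rw [show (x : AddCircle (1 : ℝ)) = e.symm w from hx, e.apply_symm_apply]⟩
  have hrpos : ∀ w, 0 < r w := fun w => by
    obtain ⟨x, rfl⟩ := hsurj w
    rw [hr]
    exact h0 x
  let c : ℝ × Circle → ℂ := fun q => (q.2 : ℂ) * (Real.exp (2 * Real.pi * (q.1 * r q.2)) : ℝ)
  have hcc : Continuous c := by
    refine (continuous_subtype_val.comp continuous_snd).mul
      (Complex.continuous_ofReal.comp (Real.continuous_exp.comp ?_))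
    exact continuous_const.mul (continuous_fst.mul (hrc.comp continuous_snd))
  have hcn : ∀ q, ‖c q‖ = Real.exp (2 * Real.pi * (q.1 * r q.2)) := fun q => by
    simp only [c]
    rw [norm_mul, Circle.norm_coe, one_mul, Complex.norm_real, Real.norm_eq_abs, Real.abs_exp]
  have hγ : Continuous fun w : Circle => c (1, w) :=
    hcc.comp (continuous_const.prodMk continuous_id)
  have hval : ∀ x : ℝ, c (1, e (x : AddCircle (1 : ℝ))) = extPoint x (ρ x) := fun x => by
    simp only [c]
    rw [he, hr, one_mul, extPoint_eq]
  refine ⟨⟨fun w => c (1, w), hγ⟩, ⟨?_, ?_, ?_⟩, ?_⟩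
  · intro w w' h
    change c (1, w) = c (1, w') at h
    obtain ⟨x, rfl⟩ := hsurj w
    obtain ⟨x', rfl⟩ := hsurj w'
    rw [hval, hval] at h
    obtain ⟨⟨k, rfl⟩, -⟩ := extPoint_eq_extPoint h
    apply Circle.ext
    rw [he, he]
    push_cast
    exact E_add_int _ _
  · intro w
    change 1 < ‖c (1, w)‖
    rw [hcn, Real.one_lt_exp_iff, one_mul]
    have := hrpos w
    have := Real.pi_pos
    positivity
  · refine ⟨⟨⟨⟨fun q => c ((q.1 : ℝ), q.2), ?_⟩, ?_, ?_⟩, ?_⟩⟩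
    · exact hcc.comp ((continuous_subtype_val.comp continuous_fst).prodMk continuous_snd)
    · intro w
      change c (0, w) = (w : ℂ)
      simp [c]
    · intro w
      simp
    · intro s w
      change 1 ≤ ‖c ((s : ℝ), w)‖
      rw [hcn]
      have := hrpos w
      have := Real.pi_pos
      have := s.2.1
      exact Real.one_le_exp (by positivity)
  · ext z
    constructor
    · rintro ⟨w, rfl⟩
      obtain ⟨x, rfl⟩ := hsurj w
      exact ⟨x, (hval x).symm⟩
    · rintro ⟨x, rfl⟩
      exact ⟨e (x : AddCircle (1 : ℝ)), hval x⟩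

/-- The set of points whose first `n` iterates, counted from the point itself, lie in `V`. -/
def iterateDomain (g : ℂ → ℂ) (V : Set ℂ) (n : ℕ) : Set ℂ := {z | ∀ i < n, g^[i] z ∈ V}

lemma isOpen_iterateDomain {g : ℂ → ℂ} {V : Set ℂ} (hV : IsOpen V) (hg : ContinuousOn g V)
    (n : ℕ) : IsOpen (iterateDomain g V n) := by
  induction n with
  | zero => simp [iterateDomain]
  | succ n ih =>
    have h : iterateDomain g V (n + 1) = V ∩ g ⁻¹' iterateDomain g V n := by
      ext z
      constructor
      · intro hz
        exact ⟨hz 0 (Nat.succ_pos _), fun i hi => hz (i + 1) (Nat.succ_lt_succ hi)⟩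
      · rintro ⟨h1, h2⟩ i hi
        cases i with
        | zero => exact h1
        | succ i => exact h2 i (Nat.lt_of_succ_lt_succ hi)
    rw [h]
    exact hg.isOpen_inter_preimage hV ih

/-! ### The quasi-invariant curves -/

/-- Small rotational distances are small distances. -/
lemma exists_gap_le {H : ℝ ≃o ℝ} (hH : ∀ (x : ℝ) (k : ℤ), H (x + k) = H x + k) {M : ℝ}
    (hM : 0 < M) : ∃ r > 0, ∀ θ : ℝ, |θ| < r → ∀ x, gap H θ x ≤ M := by
  obtain ⟨x₀, hx₀⟩ := exists_forall_le_of_periodic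
    (f := fun x => H (x + M) - H x)
    ((H.continuous.comp (continuous_id.add continuous_const)).sub H.continuous) (fun x k => by
      rw [add_right_comm, hH, hH]
      ring)
  refine ⟨H (x₀ + M) - H x₀, sub_pos.2 (H.strictMono (by linarith)), fun θ hθ x => ?_⟩
  obtain ⟨h1, h2⟩ := abs_lt.1 hθ
  have hs := apply_shift H θ x
  rw [gap, abs_le]
  constructor
  · by_contra h
    push Not at h
    have h3 := H.strictMono (show shift H θ x < x - M by linarith)
    have h4 := hx₀ (x - M)
    simp only [sub_add_cancel] at h4
    linarith
  · by_contra h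
    push Not at h
    have h3 := H.strictMono (show x + M < shift H θ x by linarith)
    have h4 := hx₀ x
    linarith

lemma map_add_int_of_map_add_one {h : ℝ ≃o ℝ} (h1 : ∀ x, h (x + 1) = h x + 1) (x : ℝ) (k : ℤ) :
    h.symm (x + k) = h.symm x + k := by
  have hp : Function.Periodic (fun x => h x - x) 1 := fun x => by
    simp only [h1]
    ring
  rw [OrderIso.symm_apply_eq]
  have := hp.int_mul k (h.symm x)
  simp only [mul_one, OrderIso.apply_symm_apply] at this
  linarith

lemma IsLinearization.linearizedLift {G : CircleDeg1Lift} {h : ℝ ≃o ℝ} (hh : IsLinearization G h)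
    {D N σ : ℝ → ℝ} {B : ℝ} (hG : SmoothLift G D N σ B) :
    LinearizedLift G D N σ B h.symm G.translationNumber where
  smooth := hG
  conj x := by
    have := hh.conj (h.symm x)
    rwa [h.apply_symm_apply] at this
  add_int := map_add_int_of_map_add_one hh.map_add_one

lemma LinearizedLift.m_eq {G : CircleDeg1Lift} {D N σ : ℝ → ℝ} {B : ℝ} {H : ℝ ≃o ℝ}
    (hL : LinearizedLift G D N σ B H G.translationNumber) (n : ℕ) (x : ℝ) :
    |m G n x| = gap H (returnDist G.translationNumber n) x := by
  have : shift H (returnDist G.translationNumber n) x =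
      G^[q G.translationNumber n] x + (-p G.translationNumber n : ℤ) := by
    apply H.injective
    rw [apply_shift, hL.add_int, hL.apply_iterate, returnDist]
    push_cast
    ring
  rw [gap, this, m]
  congr 1
  push_cast
  ring

/-- The flow acts transitively on the real line, so that a flow line is a full graph. -/
lemma toExterior_image_flowLine {G : CircleDeg1Lift} {h : ℝ ≃o ℝ}
    (hα : G.translationNumber ≠ 0) {n : ℕ} {y₀ : ℝ} {z₀ : ℂ}
    (hz₀ : z₀.im = |m G n z₀.re| * y₀) (hm : m G n z₀.re ≠ 0) :
    toExterior '' flowLine G h n z₀ = Set.range fun x => extPoint x (y₀ * |m G n x|) := by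
  have hy : z₀.im / |m G n z₀.re| = y₀ := by
    rw [hz₀, mul_div_cancel_left₀ _ (abs_ne_zero.2 hm)]
  have hpt : ∀ x : ℝ, toExterior ⟨x, |m G n x| * y₀⟩ = extPoint x (y₀ * |m G n x|) := fun x => by
    rw [toExterior, extPoint]
    congr 1
    apply Complex.ext <;> simp [mul_comm]
  ext z
  constructor
  · rintro ⟨_, ⟨t, rfl⟩, rfl⟩
    refine ⟨realFlow G h t z₀.re, ?_⟩
    simp only [complexFlow, hy]
    exact (hpt _).symm
  · rintro ⟨x, rfl⟩
    refine ⟨_, ⟨(h.symm x - h.symm z₀.re) / G.translationNumber, rfl⟩, ?_⟩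
    have hx : realFlow G h ((h.symm x - h.symm z₀.re) / G.translationNumber) z₀.re = x := by
      rw [realFlow, div_mul_cancel₀ _ hα, add_sub_cancel, h.apply_symm_apply]
    simp only [complexFlow, hy, hx]
    exact hpt x

/-- The conclusion at a single scale, once the error `δ` is small compared with the desired
distance `2 ε`. -/
lemma curve_estimates {G : CircleDeg1Lift} {D N σ : ℝ → ℝ} {B α : ℝ} {H : ℝ ≃o ℝ}
    (hLin : LinearizedLift G D N σ B H α) {V : Set ℂ} {g : ℂ → ℂ}
    (hg : IsHolomorphicExtension G V g) {L : ℝ → ℂ → ℂ} {Δ Δ' K K' : ℝ}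
    (hL : LocalLift G D N V g L Δ K) (hΔ : Δ' ≤ Δ) (hK : 0 < K')
    (hstep : ∀ (x : ℝ) (ζ : ℂ), ζ ≠ 0 → ‖ζ‖ < Δ' →
      L x ζ ≠ 0 ∧ ‖D x / L x ζ - (1 / ζ - N x / 2)‖ ≤ K' * ‖ζ‖)
    {θ C δ y₀ κ ε : ℝ} {Q : ℕ} {P : ℤ} (hθ : θ ≠ 0) (hret : |Q * α - P| ≤ |θ|)
    (hS : ScaleEstimates G D N H θ Q C δ)
    (hy₀ : 0 < y₀) (hκ : κ = y₀ * δ / 2 + 2 * K' * y₀ ^ 2 * δ) (hκ2 : κ ≤ 1 / 2)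
    (hδ : δ ≤ 1 / 2) (hδΔ : 2 * y₀ * δ < Δ') (hε : ε ≤ 1 / 2)
    (hε1 : C / y₀ + 2 * (4 * κ + 2 * δ) + 2 * δ ≤ ε) :
    regionBelow (fun x => y₀ * gap H θ x) ⊆ iterateDomain g V Q ∧
      (∀ j ≤ Q, ∀ x, 1 < ‖g^[j] (extPoint x (y₀ * gap H θ x))‖ ∧
        dP (g^[j] (extPoint x (y₀ * gap H θ x)))
          (extPoint (G^[j] x) (y₀ * gap H θ (G^[j] x))) ≤ ENNReal.ofReal (2 * ε)) ∧
      ∀ x, dP (g^[Q] (extPoint x (y₀ * gap H θ x))) (extPoint x (y₀ * gap H θ x)) ≤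
        ENNReal.ofReal (2 * ε) := by
  have hG := hLin.smooth
  have hδ0 : 0 ≤ δ := (abs_nonneg _).trans (hS.gap_return 0)
  have hκ0 : 0 ≤ κ := by rw [hκ]; positivity
  have hC0 : 0 ≤ C := by
    have h1 := hS.return_le 0 0 (by simp)
    have h2 := gap_pos H hθ 0
    simp only [sub_self, abs_zero] at h1
    exact nonneg_of_mul_nonneg_left h1 h2
  have hCy : 0 ≤ C / y₀ := by positivity
  have horb : ∀ (x : ℝ) (ζ : ℂ), ζ ≠ 0 → ‖ζ‖ ≤ y₀ * gap H θ x → ∀ j ≤ Q,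
      dispIter G L x ζ j ≠ 0 ∧ ‖dispIter G L x ζ j‖ < Δ' ∧
        ‖ζ * derivIter G D j x / dispIter G L x ζ j - 1‖ ≤ κ := by
    intro x ζ hζ0 hζ j hj
    rw [hκ]
    exact dispIter_estimate hG hS hK hy₀ hstep (by rw [← hκ]; exact hκ2) hδΔ hζ0 hζ hj
  have hne : ∀ t : ℝ, 0 < t → -(Complex.I * (t : ℝ)) ≠ 0 := fun t ht =>
    neg_ne_zero.2 (mul_ne_zero Complex.I_ne_zero (by exact_mod_cast ht.ne'))
  have hnorm : ∀ t : ℝ, 0 ≤ t → ‖-(Complex.I * (t : ℝ))‖ = t := fun t ht => by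
    rw [norm_neg, norm_mul, Complex.norm_I, one_mul, Complex.norm_real, Real.norm_eq_abs,
      abs_of_nonneg ht]
  have hgap : ∀ x, 0 < y₀ * gap H θ x := fun x => mul_pos hy₀ (gap_pos H hθ x)
  have hiter : ∀ (x : ℝ) (j : ℕ), j ≤ Q → ∃ ζ : ℂ,
      g^[j] (extPoint x (y₀ * gap H θ x)) = E ((G^[j] x : ℝ) + ζ) ∧
        ‖ζ + Complex.I * (y₀ * gap H θ (G^[j] x) : ℝ)‖ ≤
          (4 * κ + 2 * δ) * (y₀ * gap H θ (G^[j] x)) := by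
    intro x j hj
    have h1 := horb x _ (hne _ (hgap x)) (hnorm _ (hgap x).le).le
    refine ⟨dispIter G L x (-(Complex.I * (y₀ * gap H θ x : ℝ))) j,
      hL.iterate_E (fun i hi => (h1 i hi).2.1.trans_le hΔ) hj, ?_⟩
    exact norm_dispIter_sub_le hS hθ hy₀ hδ hκ2 hj (hG.derivIter_pos j x) rfl (h1 j hj).1
      (h1 j hj).2.2
  refine ⟨?_, ?_, ?_⟩
  · rintro z ⟨x, t, ht0, ht, rfl⟩ i hi
    rcases ht0.eq_or_lt with rfl | ht'
    · rw [extPoint_zero, iterate_E_ofReal hg]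
      exact hg.circle_subset (by simp [norm_E_ofReal])
    · have h1 := horb x _ (hne t ht') ((hnorm t ht0).le.trans ht)
      rw [extPoint, hL.iterate_E (fun i hi => (h1 i hi).2.1.trans_le hΔ) hi.le]
      exact hL.mem _ _ ((h1 i hi.le).2.1.trans_le hΔ)
  · intro j hj x
    obtain ⟨ζ, h1, h2⟩ := hiter x j hj
    rw [h1]
    refine dP_E_le_of_norm_le (hgap _) hε (h2.trans ?_)
    exact mul_le_mul_of_nonneg_right (by linarith) (hgap _).le
  · intro x
    obtain ⟨ζ, h1, h2⟩ := hiter x Q le_rfl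
    -- Move the iterate back next to `x` by the integer translation.
    set x' := G^[Q] x + ((-P : ℤ) : ℝ)
    have hg' : gap H θ (G^[Q] x) = gap H θ x' := (hLin.gap_add_int _ _).symm
    have hx' : |x' - x| ≤ C * gap H θ x := by
      refine hS.return_le x x' ?_
      rw [hLin.add_int, hLin.apply_iterate]
      push_cast
      have : H x + Q * α + -P - H x = Q * α - P := by ring
      rwa [this]
    set s := gap H θ x
    set s' := gap H θ x'
    have hs : 0 < s := gap_pos H hθ x
    have hs' : 0 < s' := gap_pos H hθ x'
    have hr : |s' / s - 1| ≤ 2 * δ := by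
      refine abs_sub_one_le_of_abs_log_le (div_pos hs' hs) (by linarith) ?_
      rw [Real.log_div hs'.ne' hs.ne', ← hg']
      exact hS.gap_return x
    have hs's : |s' - s| ≤ 2 * δ * s := by
      have e : s' - s = (s' / s - 1) * s := by field_simp
      rw [e, abs_mul, abs_of_pos hs]
      exact mul_le_mul_of_nonneg_right hr hs.le
    have hs'2 : s' ≤ 2 * s := by nlinarith [(abs_le.1 hs's).2]
    have e1 : g^[Q] (extPoint x (y₀ * s)) = E (x + (((x' - x : ℝ) : ℂ) + ζ)) := by
      rw [h1, ← E_add_int _ (-P)]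
      congr 1
      simp only [x']
      push_cast
      ring
    rw [e1]
    refine (dP_E_le_of_norm_le (s := ε) (hgap x) hε ?_).2
    have e2 : ((x' - x : ℝ) : ℂ) + ζ + Complex.I * (y₀ * s : ℝ) =
        ((x' - x : ℝ) : ℂ) + (ζ + Complex.I * (y₀ * gap H θ (G^[Q] x) : ℝ)) +
          -(Complex.I * (y₀ * (s' - s) : ℝ)) := by
      rw [hg']
      push_cast
      ring
    rw [hg'] at h2
    rw [e2, hg']
    refine (norm_add_le _ _).trans ((add_le_add (norm_add_le _ _) le_rfl).trans ?_)
    have n1 : ‖((x' - x : ℝ) : ℂ)‖ ≤ C / y₀ * (y₀ * s) := by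
      rw [Complex.norm_real, Real.norm_eq_abs]
      refine hx'.trans (le_of_eq ?_)
      field_simp
    have n2 : (4 * κ + 2 * δ) * (y₀ * s') ≤ (4 * κ + 2 * δ) * (y₀ * (2 * s)) := by gcongr
    have n3 : ‖-(Complex.I * (y₀ * (s' - s) : ℝ))‖ ≤ 2 * δ * (y₀ * s) := by
      rw [norm_neg, norm_mul, Complex.norm_I, one_mul, Complex.norm_real, Real.norm_eq_abs,
        abs_mul, abs_of_pos hy₀]
      calc y₀ * |s' - s| ≤ y₀ * (2 * δ * s) := by gcongr
        _ = _ := by ring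
    have n4 := mul_le_mul_of_nonneg_right hε1 (hgap x).le
    change _ ≤ ε * (y₀ * s)
    change _ ≤ ε * (y₀ * s) at n4
    linarith

end QuasiInvariant

theorem mainTheorem2 (G : CircleDeg1Lift) (hG : IsAnalyticCircleDiffeo G)
    (hα : Irrational G.translationNumber)
    (V : Set ℂ) (g : ℂ → ℂ) (hg : IsHolomorphicExtension G V g) :
    ∃ h : ℝ ≃o ℝ, IsLinearization G h ∧
      ∀ C₀ : ℝ, 0 < C₀ →
        ∃ y₀ : ℝ, 1 / 2 < y₀ ∧
        ∃ n₀ : ℕ, 1 ≤ n₀ ∧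
        ∃ γ : ℕ → C(Circle, ℂ), ∀ n ≥ n₀,
          IsExteriorJordanCurve (γ n) ∧
          (∃ z₀ : ℂ, z₀.im = |m G (n - 1) z₀.re| * y₀ ∧
            Set.range (γ n) = toExterior '' flowLine G h (n - 1) z₀) ∧
          (∃ W : Set ℂ, IsOpen W ∧ closure (annulus (Set.range (γ n))) ⊆ W ∧
            ∀ j ≤ q G.translationNumber n, IterateDefinedOn g V j W) ∧
          (∀ j ≤ q G.translationNumber n,
            (∀ z ∈ Set.range (γ n), 1 < ‖g^[j] z‖) ∧
            hausdorffP (g^[j] '' Set.range (γ n)) (Set.range (γ n)) ≤ ENNReal.ofReal C₀) ∧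
          (∀ z ∈ Set.range (γ n),
            dP (g^[q G.translationNumber n] z) z ≤ ENNReal.ofReal C₀) := by
  obtain ⟨D, N, σ, B, hS⟩ := exists_smoothLift hG
  obtain ⟨h, hh⟩ := exists_isLinearization hS hα
  refine ⟨h, hh, fun C₀ hC₀ => ?_⟩
  set α := G.translationNumber
  set H := h.symm
  have hLin : LinearizedLift G D N σ B H α := hh.linearizedLift hS
  obtain ⟨Δ, hΔ, K, hK, L, hL⟩ := exists_localLift hS hg
  obtain ⟨Δ', hΔ', hΔΔ', K', hK', hstep⟩ := hL.norm_div_sub_le hS hΔ hK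
  obtain ⟨C₁, hC₁, C₂, hC₂, hscale⟩ := exists_scaleEstimates hLin
  set ε := min C₀ 1 / 2
  have hε : 0 < ε := by positivity
  have hεC : 2 * ε ≤ C₀ := by
    simp only [ε]
    linarith [min_le_left C₀ 1]
  have hε1 : ε ≤ 1 / 2 := by
    simp only [ε]
    linarith [min_le_right C₀ 1]
  -- The height is chosen so that the displacement under `G^{q_n}` is hyperbolically small.
  set y₀ := 1 + 2 * C₁ / ε
  have hy₀ : 1 ≤ y₀ := le_add_of_nonneg_right (by positivity)
  have hy₀0 : 0 < y₀ := by linarith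
  have hCy : C₁ / y₀ ≤ ε / 2 := by
    rw [div_le_iff₀ hy₀0]
    have : ε / 2 * y₀ = ε / 2 + C₁ := by
      simp only [y₀]
      field_simp
    linarith
  -- The error allowed at a scale, for this height.
  obtain ⟨M, hM, hMκ, hM1, hMΔ, hMε⟩ : ∃ M > 0,
      y₀ * (C₂ * (√M + M)) / 2 + 2 * K' * y₀ ^ 2 * (C₂ * (√M + M)) ≤ 1 / 2 ∧
      C₂ * (√M + M) ≤ 1 / 2 ∧ 2 * y₀ * (C₂ * (√M + M)) < Δ' ∧
      2 * (4 * (y₀ * (C₂ * (√M + M)) / 2 + 2 * K' * y₀ ^ 2 * (C₂ * (√M + M))) +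
        2 * (C₂ * (√M + M))) + 2 * (C₂ * (√M + M)) ≤ ε / 2 := by
    have key : ∀ F : ℝ → ℝ, Continuous F → F 0 = 0 → ∀ b : ℝ, 0 < b →
        ∀ᶠ M in nhdsWithin (0 : ℝ) (Set.Ioi 0), F M < b := fun F hF h0 b hb =>
      (hF.continuousAt.eventually (gt_mem_nhds (by rw [h0]; exact hb))).filter_mono
        nhdsWithin_le_nhds
    have k1 := key (fun M => y₀ * (C₂ * (√M + M)) / 2 + 2 * K' * y₀ ^ 2 * (C₂ * (√M + M)))
      (by fun_prop) (by simp) (1 / 2) (by norm_num)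
    have k2 := key (fun M => C₂ * (√M + M)) (by fun_prop) (by simp) (1 / 2) (by norm_num)
    have k3 := key (fun M => 2 * y₀ * (C₂ * (√M + M))) (by fun_prop) (by simp) Δ' hΔ'
    have k4 := key (fun M => 2 * (4 * (y₀ * (C₂ * (√M + M)) / 2 +
      2 * K' * y₀ ^ 2 * (C₂ * (√M + M))) + 2 * (C₂ * (√M + M))) + 2 * (C₂ * (√M + M)))
      (by fun_prop) (by simp) (ε / 2) (by positivity)
    obtain ⟨M, h1, h2, h3, h4, h5⟩ :=
      (k1.and (k2.and (k3.and (k4.and self_mem_nhdsWithin)))).exists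
    exact ⟨M, h5, h1.le, h2.le, h3, h4.le⟩
  obtain ⟨r, hr, hgapM⟩ := exists_gap_le hLin.add_int hM
  obtain ⟨n₁, hn₁⟩ := Filter.eventually_atTop.1 ((tendsto_returnDist hα).eventually
    (gt_mem_nhds hr))
  have hθ0 : ∀ n, returnDist α n ≠ 0 := fun n => abs_pos.1 (abs_returnDist_pos hα n)
  have hJ : ∀ n, ∃ γ : C(Circle, ℂ), IsExteriorJordanCurve γ ∧
      Set.range γ = Set.range fun x => extPoint x (y₀ * gap H (returnDist α (n - 1)) x) :=
    fun n => exists_exteriorJordanCurve ((continuous_gap H _).const_mul y₀)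
      (fun x => mul_pos hy₀0 (gap_pos H (hθ0 _) x)) (fun x k => by rw [hLin.gap_add_int])
  choose γ hγ hγr using hJ
  refine ⟨y₀, by linarith, n₁ + 2, by omega, γ, fun n hn => ⟨hγ n, ?_⟩⟩
  obtain ⟨n, rfl⟩ : ∃ k, n = k + 2 := ⟨n - 2, by omega⟩
  have hn' : n₁ ≤ n + 1 := by omega
  rw [hγr (n + 2)]
  simp only [show n + 2 - 1 = n + 1 from rfl]
  set θ := returnDist α (n + 1)
  set Q := q α (n + 2)
  have hE : ScaleEstimates G D N H θ Q C₁ (C₂ * (√M + M)) :=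
    hscale |θ| _ θ M Q _ (p α (n + 1)) (rotationScale hα (n + 1)) (rotationScale hα n) rfl rfl
      (hgapM θ (hn₁ (n + 1) hn'))
  obtain ⟨r1, r2, r3⟩ := curve_estimates hLin hg hL hΔΔ' hK' hstep (hθ0 (n + 1))
    (P := p α (n + 2)) (returnDist_step (n + 1) hα).2.1.le hE hy₀0 rfl hMκ hM1 hMΔ hε1
    (by linarith)
  have hC : ENNReal.ofReal (2 * ε) ≤ ENNReal.ofReal C₀ := ENNReal.ofReal_le_ofReal hεC
  refine ⟨?_, ?_, ?_, ?_⟩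
  · have hm : ∀ x, |m G (n + 1) x| = gap H θ x := hLin.m_eq (n + 1)
    refine ⟨⟨0, |m G (n + 1) 0| * y₀⟩, rfl, ?_⟩
    rw [toExterior_image_flowLine hα.ne_zero rfl
      (abs_pos.1 (by rw [hm]; exact gap_pos H (hθ0 _) _))]
    simp only [hm]
  · refine ⟨iterateDomain g V Q, isOpen_iterateDomain hg.isOpen hg.holomorphic.continuousOn Q,
      ?_, fun j hj i hi z hz => hz i (hi.trans_le hj)⟩
    refine (closure_minimal (annulus_subset_regionBelow fun x k => ?_)
      (isClosed_regionBelow ?_ (fun x => ?_) fun x k => ?_)).trans r1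
    · rw [hLin.gap_add_int]
    · exact (continuous_gap H _).const_mul y₀
    · exact (mul_pos hy₀0 (gap_pos H (hθ0 _) x)).le
    · rw [hLin.gap_add_int]
  · intro j hj
    refine ⟨?_, ?_⟩
    · rintro _ ⟨x, rfl⟩
      exact (r2 j hj x).1
    · refine max_le ?_ ?_
      · refine iSup₂_le ?_
        rintro _ ⟨_, ⟨x, rfl⟩, rfl⟩
        exact (iInf₂_le _ ⟨G^[j] x, rfl⟩).trans (((r2 j hj x).2).trans hC)
      · refine iSup₂_le ?_
        rintro _ ⟨x, rfl⟩
        obtain ⟨x, rfl⟩ := hS.surjective.iterate j x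
        refine (iInf₂_le _ ⟨_, ⟨x, rfl⟩, rfl⟩).trans ?_
        rw [dP_comm]
        exact ((r2 j hj x).2).trans hC
  · rintro _ ⟨x, rfl⟩
    exact (r3 x).trans hC
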